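/- Let $X$ be a random variable on $\mathbb{Z}_+=\{0,1,2,\dots\}$ with mass function $p_X$ and finite mean $\lambda_X$, and let $Y$ be independent of $X$ and geometric with mean $\lambda_Y>0$, i.e. $p_Y[n]=\lambda_Y^n/(1+\lambda_Y)^{n+1}$ for $n\ge 0$. For a random variable $W$ on $\mathbb{Z}_+$ let $\mathcal{T}(W)$ denote the circularly symmetric random variable on $\mathbb{C}$ with density $$p_{\mathcal T(W)}(r)=\sum_{n\ge 0}p_W[n]\,\frac{e^{-|r|^2}|r|^{2n}}{n!\,\pi},$$ and let $\mathcal{T}^{-1}$ be the inverse map, which takes a density $p$ on $\mathbb{C}$ to the mass function $$n\mapsto \frac1\pi\int_{\mathbb{C}}\Big(\int_{\mathbb{C}} p(r)\,\mathcal{L}_n(|s|^2)\,e^{r\bar s-\bar r s}\,dr\Big)ds,\qquad \mathcal{L}_n(x)=\sum_{m=0}^n\binom nm\frac{(-x)^m}{m!}.$$ For $0<\eta<1$ let $Z_\eta=X\boxplus_\eta Y:=\mathcal{T}^{-1}\big(\sqrt{\eta}\,\mathcal{T}(X)+\sqrt{1-\eta}\,\mathcal{T}(Y)\big)$, where $\mathcal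 T(X)$ and $\mathcal T(Y)$ are independent, and let $G_\eta$ be geometric with mean $\lambda(\eta)=\eta\lambda_X+(1-\eta)\lambda_Y$. Write $p_\eta$ for the mass function of $Z_\eta$; it is a probability mass function with mean $\lambda(\eta)$. Define the probability mass functions $$p_\eta^+[n]=\frac{(n+1)\,p_\eta[n+1]}{\lambda(\eta)},\qquad p_\eta^-[n]=\frac{(n+1)\,p_\eta[n]}{1+\lambda(\eta)},\qquad n\ge 0.$$ Let $D(p\|q)=\sum_n p[n]\log(p[n]/q[n])$ denote relative entropy (with natural logarithm). Then for every $\eta\in(0,1)$ the relative entropies $D(Z_\eta\|G_\eta)$, $D(p_\eta^-\|p_\eta^+)$ and $D(p_\eta^+\|p_\eta^-)$ are finite, the function $\eta\mapsto D(Z_\eta\|G_\eta)$ is differentiable at $\eta$, and $$\frac{\partial}{\partial\eta}D(Z_\eta\|G_\eta)=\frac{\lambda_Y(1+\lambda(\eta))}{\eta}\,D(p_\eta^-\|p_\eta^+)+\frac{(1+\lambda_Y)\,\lambda(\eta)}{\eta}\,D(p_\eta^+\|p_\eta^-).$$ -/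

import Mathlib

open MeasureTheory
open scoped ENNReal

noncomputable section

/-- `p` is a probability mass function on the non-negative integers. -/
structure IsMassFunction (p : ℕ → ℝ) : Prop where
  nonneg : ∀ n, 0 ≤ p n
  hasSum : HasSum p 1

/-- The mean of a mass function on `ℕ` (meaningful when `n ↦ n * p n` is summable). -/
def massMean (p : ℕ → ℝ) : ℝ := ∑' n : ℕ, (n : ℝ) * p n

/-- The geometric mass function on `ℕ` with mean `l`, that is, with success probability
`1 / (1 + l)`. -/
def geometricMass (l : ℝ) (n : ℕ) : ℝ := l ^ n / (1 + l) ^ (n + 1)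

/-- The Laguerre polynomial of degree `n`, evaluated at `x`. -/
def laguerre (n : ℕ) (x : ℝ) : ℝ :=
  ∑ m ∈ Finset.range (n + 1), (n.choose m : ℝ) * (-x) ^ m / (m.factorial : ℝ)

/-- The density on `ℂ` of the continuous counterpart of an integer random variable with
mass function `p`. -/
def counterpartDensity (p : ℕ → ℝ) (r : ℂ) : ℝ :=
  ∑' n : ℕ, p n * (Real.exp (-‖r‖ ^ 2) * ‖r‖ ^ (2 * n) / ((n.factorial : ℝ) * Real.pi))

/-- The map `T`: the law on `ℂ` of the continuous counterpart. -/
def counterpart (p : ℕ → ℝ) : Measure ℂ :=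
  volume.withDensity fun r => ENNReal.ofReal (counterpartDensity p r)

/-- The inverse map `T⁻¹`, from laws on `ℂ` to mass functions on `ℕ`. For a circularly symmetric
law the integral is real. -/
def counterpartInv (μ : Measure ℂ) (n : ℕ) : ℝ :=
  ((1 / (Real.pi : ℂ)) * ∫ s : ℂ, ∫ r : ℂ, (laguerre n (‖s‖ ^ 2) : ℂ) *
    Complex.exp (r * (starRingEnd ℂ) s - (starRingEnd ℂ) r * s) ∂μ).re

/-- The law of `√η U + √(1 - η) V` for independent `U` and `V` with laws `μ` and `ν`. -/
def scaledSum (η : ℝ) (μ ν : Measure ℂ) : Measure ℂ :=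
  (μ.prod ν).map fun w => (Real.sqrt η : ℂ) * w.1 + (Real.sqrt (1 - η) : ℂ) * w.2

/-- Beamsplitter addition with transmissivity `η`: the mass function of `X ⊞_η Y` for independent
`X` and `Y` with mass functions `p` and `q`. -/
def beamsplitterAdd (η : ℝ) (p q : ℕ → ℝ) : ℕ → ℝ :=
  counterpartInv (scaledSum η (counterpart p) (counterpart q))

/-- The mass function `p⁺`. -/
def massPlus (p : ℕ → ℝ) (n : ℕ) : ℝ := ((n : ℝ) + 1) * p (n + 1) / massMean p

/-- The mass function `p⁻`. -/
def massMinus (p : ℕ → ℝ) (n : ℕ) : ℝ := ((n : ℝ) + 1) * p n / (1 + massMean p)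

/-- The law on `ℕ` with mass function `p`. -/
def massLaw (p : ℕ → ℝ) : Measure ℕ :=
  Measure.count.withDensity fun n => ENNReal.ofReal (p n)

/-- Relative entropy `D(p ‖ q)` of mass functions, with values in `[0, ∞]`. -/
def relEntropy (p q : ℕ → ℝ) : ℝ≥0∞ :=
  InformationTheory.klDiv (massLaw p) (massLaw q)

end

noncomputable section

/-! The counterpart of a geometric variable is a centred Gaussian, so the Laguerre generating
function turns the inversion formula into an explicit power series. It is the generating function of
binomial thinning followed by negative binomial amplification
(`beamsplitterAdd_eq_amplified_thinned`). The two parameters are smooth in `t`, and differentiating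
the kernels gives a birth and death equation (`hasDerivAt_attenuated`): in time `-log t`, state `n`
has birth rate `l (n + 1)` and death rate `(1 + l) n`. Hence `t` times the derivative of the mass at
`n` is `J n - J (n - 1)`, where `J` is `attenuatedCurrent`.

Formally, summation by parts gives the derivative of `∑ P log P` as `(1 / t) ∑ J n (log P n - log P
(n + 1))`. The two terms of `J` are averages against `p⁻` and `p⁺`, and the logarithmic increment is
`log (p⁻ / p⁺)` up to a constant. The constants are matched by the derivative of `(1 + λ) log (1 +
λ) - λ log λ`, which is what the geometric reference contributes.

The analytic difficulty is that only the mean is finite. Amplification makes the ratios `P (n + 1) /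
P n` bounded above and below, uniformly for `t` in compact subsets of `(0, 1)`
(`attenuated_bounds`). So the increments of `log P` are bounded, `log P n` is at most linear in `n`,
and all series above converge. The boundary term of a sharply truncated sum is nevertheless
controlled only by `n ^ 2 P n`, which need not tend to zero. Cesàro sums average this term: their
error is at most a constant times the Cesàro deficiency of the first moment
(`abs_cesaro_sub_tsum_le`). That deficiency vanishes locally uniformly by Dini's theorem, because
the mean is continuous in `t`; this justifies the differentiation (`hasDerivAt_tsum_mul_log`). -/

/-! ### Relative entropy on the non-negative integers -/

theorem massLaw_univ {p : ℕ → ℝ} (hp : IsMassFunction p) : massLaw p Set.univ = 1 := by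
  rw [massLaw, withDensity_apply _ MeasurableSet.univ, Measure.restrict_univ, lintegral_count,
    ← ENNReal.ofReal_tsum_of_nonneg hp.nonneg hp.hasSum.summable, hp.hasSum.tsum_eq,
    ENNReal.ofReal_one]

theorem integrable_massLaw {p : ℕ → ℝ} (hp : ∀ n, 0 ≤ p n) {f : ℕ → ℝ}
    (hf : Summable fun n => p n * f n) : Integrable f (massLaw p) := by
  rw [← summable_abs_iff] at hf
  rw [massLaw, integrable_withDensity_iff_integrable_smul₀' (measurable_of_countable _).aemeasurable
    (Filter.Eventually.of_forall fun _ => ENNReal.ofReal_lt_top), integrable_count_iff]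
  refine hf.congr fun n => ?_
  simp [ENNReal.toReal_ofReal (hp n), abs_mul]

theorem integral_massLaw {p : ℕ → ℝ} (hp : ∀ n, 0 ≤ p n) {f : ℕ → ℝ}
    (hf : Summable fun n => p n * f n) : ∫ n, f n ∂(massLaw p) = ∑' n, p n * f n := by
  rw [massLaw, integral_withDensity_eq_integral_toReal_smul (measurable_of_countable _)
    (Filter.Eventually.of_forall fun _ => ENNReal.ofReal_lt_top), integral_countable]
  · refine tsum_congr fun n => ?_
    simp [ENNReal.toReal_ofReal (hp n), Measure.real]
  · rw [integrable_count_iff]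
    rw [← summable_abs_iff] at hf
    refine hf.congr fun n => ?_
    simp [ENNReal.toReal_ofReal (hp n), abs_mul]

theorem massLaw_eq_withDensity {p q : ℕ → ℝ} (hq : ∀ n, 0 < q n) :
    massLaw p = (massLaw q).withDensity fun n => ENNReal.ofReal (p n / q n) := by
  rw [massLaw, massLaw, ← withDensity_mul _ (measurable_of_countable _) (measurable_of_countable _)]
  congr 1
  ext n
  rw [Pi.mul_apply, ← ENNReal.ofReal_mul (hq n).le, mul_div_cancel₀ _ (hq n).ne']

/-- Relative entropy of mass functions as a series. -/
theorem relEntropy_eq_tsum {p q : ℕ → ℝ} (hp : IsMassFunction p) (hq : IsMassFunction q)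
    (hq0 : ∀ n, 0 < q n) (hs : Summable fun n => p n * Real.log (p n / q n)) :
    relEntropy p q ≠ ∞ ∧ (relEntropy p q).toReal = ∑' n, p n * Real.log (p n / q n) := by
  have : IsFiniteMeasure (massLaw p) := ⟨by rw [massLaw_univ hp]; exact ENNReal.one_lt_top⟩
  have : IsFiniteMeasure (massLaw q) := ⟨by rw [massLaw_univ hq]; exact ENNReal.one_lt_top⟩
  have hac : massLaw p ≪ massLaw q := by
    rw [massLaw_eq_withDensity (p := p) hq0]
    exact withDensity_absolutelyContinuous _ _
  have hllr : llr (massLaw p) (massLaw q) =ᵐ[massLaw p] fun n => Real.log (p n / q n) := by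
    have h : (massLaw p).rnDeriv (massLaw q) =ᵐ[massLaw q]
        fun n => ENNReal.ofReal (p n / q n) := by
      have := Measure.rnDeriv_withDensity (massLaw q)
        (f := fun n => ENNReal.ofReal (p n / q n)) (measurable_of_countable _)
      rwa [← massLaw_eq_withDensity hq0] at this
    filter_upwards [hac.ae_le h] with n hn
    rw [llr, hn, ENNReal.toReal_ofReal (div_nonneg (hp.nonneg n) (hq0 n).le)]
  have hint : Integrable (llr (massLaw p) (massLaw q)) (massLaw p) :=
    (integrable_congr hllr).2 (integrable_massLaw hp.nonneg hs)
  refine ⟨InformationTheory.klDiv_ne_top hac hint, ?_⟩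
  -- For measures of equal mass the correction term in `klDiv` disappears, leaving the integral of
  -- the log-likelihood ratio.
  rw [relEntropy, InformationTheory.toReal_klDiv_of_measure_eq hac
    (by rw [massLaw_univ hp, massLaw_univ hq]), integral_congr_ae hllr,
    integral_massLaw hp.nonneg hs]

/-! ### Characters, Gaussians and Laguerre polynomials -/

theorem integral_character_mul_gaussian {a : ℝ} (ha : 0 < a) (s : ℂ) :
    ∫ r : ℂ, Complex.exp (r * (starRingEnd ℂ) s - (starRingEnd ℂ) r * s) *
      (Real.exp (-a * ‖r‖ ^ 2) : ℂ) = (Real.pi / a : ℝ) * (Real.exp (-‖s‖ ^ 2 / a) : ℝ) := by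
  -- The exponent `r s̄ - r̄ s` is `2 i` times the real inner product of `i s` and `r`, so this is a
  -- Gaussian Fourier transform on a real plane.
  have h := GaussianFourier.integral_cexp_neg_mul_sq_norm_add (V := ℂ) (b := (a : ℂ)) (by simpa using ha)
    (2 * Complex.I) (Complex.I * s)
  have h2 : ((Module.finrank ℝ ℂ : ℕ) : ℂ) / 2 = 1 := by
    rw [Complex.finrank_real_complex]; norm_num
  rw [h2, Complex.cpow_one] at h
  have hr : ∀ r : ℂ, Complex.exp (r * (starRingEnd ℂ) s - (starRingEnd ℂ) r * s) *
      (Real.exp (-a * ‖r‖ ^ 2) : ℂ) =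
      Complex.exp (-(a : ℂ) * ‖r‖ ^ 2 + 2 * Complex.I * (inner ℝ (Complex.I * s) r : ℝ)) := by
    intro r
    rw [Complex.ofReal_exp, ← Complex.exp_add]
    congr 1
    push_cast
    rw [add_comm]
    congr 1
    apply Complex.ext <;> simp [Complex.inner]; ring
  simp_rw [hr, h]
  push_cast
  congr 2
  have : (2 * Complex.I) ^ 2 = -4 := by rw [mul_pow, Complex.I_sq]; norm_num
  rw [this]
  have ha' : (a : ℂ) ≠ 0 := by exact_mod_cast ha.ne'
  simp
  field_simp

theorem norm_character (r s : ℂ) :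
    ‖Complex.exp (r * (starRingEnd ℂ) s - (starRingEnd ℂ) r * s)‖ = 1 := by
  rw [Complex.norm_exp]
  have : (r * (starRingEnd ℂ) s - (starRingEnd ℂ) r * s).re = 0 := by
    simp
  rw [this, Real.exp_zero]

/-- Each `u ^ m / m!` is at most `M ^ m * exp (u / M)`, and the binomial theorem sums the rest. The
free `M` lets a Gaussian factor absorb the exponential at the cost of geometric growth in `n`. -/
theorem abs_laguerre_le {u M : ℝ} (hu : 0 ≤ u) (hM : 0 < M) (n : ℕ) :
    |laguerre n u| ≤ (1 + M) ^ n * Real.exp (u / M) := by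
  rw [laguerre, add_comm 1 M, add_pow, Finset.sum_mul]
  refine (Finset.abs_sum_le_sum_abs _ _).trans (Finset.sum_le_sum fun m _ => ?_)
  rw [abs_div, abs_mul, abs_pow, abs_neg, abs_of_nonneg hu, Nat.abs_cast, Nat.abs_cast, one_pow,
    mul_one]
  have h := Real.pow_div_factorial_le_exp (u / M) (by positivity) m
  rw [div_pow] at h
  have h2 : u ^ m / (m.factorial : ℝ) ≤ M ^ m * Real.exp (u / M) := by
    calc u ^ m / (m.factorial : ℝ) = M ^ m * (u ^ m / M ^ m / (m.factorial : ℝ)) := by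
          field_simp
      _ ≤ _ := by gcongr
  calc (n.choose m : ℝ) * u ^ m / (m.factorial : ℝ)
      = (n.choose m : ℝ) * (u ^ m / (m.factorial : ℝ)) := by ring
    _ ≤ (n.choose m : ℝ) * (M ^ m * Real.exp (u / M)) := by gcongr
    _ = _ := by ring

theorem hasSum_choose_mul_pow (j : ℕ) {y : ℝ} (hy : |y| < 1) :
    HasSum (fun n : ℕ => (n.choose j : ℝ) * y ^ n) (y ^ j / (1 - y) ^ (j + 1)) := by
  have h := (hasSum_choose_mul_geometric_of_norm_lt_one j
    (show ‖y‖ < 1 by simpa using hy)).mul_left (y ^ j)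
  have hz : ∀ i ∈ Finset.range j, (i.choose j : ℝ) * y ^ i = 0 := fun i hi => by
    rw [Nat.choose_eq_zero_of_lt (Finset.mem_range.1 hi)]; simp
  rw [← hasSum_nat_add_iff' j, Finset.sum_eq_zero hz, sub_zero]
  have e : (fun n : ℕ => ((n + j).choose j : ℝ) * y ^ (n + j)) =
      fun n : ℕ => y ^ j * (((n + j).choose j : ℝ) * y ^ n) := by
    ext n; ring
  rw [← mul_one_div, e]
  exact h

/-- Summing over `n` before `m` leaves an exponential series. Replacing `-u` by `u` gives the
absolute convergence that permits the interchange. -/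
theorem hasSum_pow_mul_laguerre {u y : ℝ} (hu : 0 ≤ u) (hy0 : 0 ≤ y) (hy : y < 1) :
    HasSum (fun n : ℕ => y ^ n * laguerre n u) (Real.exp (-(y / (1 - y)) * u) / (1 - y)) := by
  have hy1 : 0 < 1 - y := by linarith
  have habs : |y| < 1 := by rwa [abs_of_nonneg hy0]
  let f : ℕ × ℕ → ℝ := fun z => (-u) ^ z.1 / (z.1.factorial : ℝ) * ((z.2.choose z.1 : ℝ) * y ^ z.2)
  have hrow : ∀ m, HasSum (fun n => f (m, n))
      ((-u) ^ m / (m.factorial : ℝ) * (y ^ m / (1 - y) ^ (m + 1))) := fun m =>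
    (hasSum_choose_mul_pow m habs).mul_left _
  have hexp : ∀ v : ℝ, HasSum
      (fun m : ℕ => v ^ m / (m.factorial : ℝ) * (y ^ m / (1 - y) ^ (m + 1)))
      (Real.exp (y / (1 - y) * v) / (1 - y)) := fun v => by
    have := (NormedSpace.expSeries_div_hasSum_exp (y / (1 - y) * v)).div_const (1 - y)
    rw [← Real.exp_eq_exp_ℝ] at this
    have e : (fun m : ℕ => v ^ m / (m.factorial : ℝ) * (y ^ m / (1 - y) ^ (m + 1))) =
        fun m : ℕ => (y / (1 - y) * v) ^ m / (m.factorial : ℝ) / (1 - y) := by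
      ext m
      rw [mul_pow, div_pow, pow_succ (1 - y)]
      field_simp
    rw [e]
    exact this
  have hsum : Summable f := by
    refine Summable.of_norm ?_
    have hn : (fun z => ‖f z‖) =
        fun z : ℕ × ℕ => u ^ z.1 / (z.1.factorial : ℝ) * ((z.2.choose z.1 : ℝ) * y ^ z.2) := by
      ext z
      simp only [f, norm_mul, norm_div, norm_pow, norm_neg, Real.norm_natCast,
        Real.norm_of_nonneg hu, Real.norm_of_nonneg hy0]
    rw [hn, summable_prod_of_nonneg (fun z => by positivity)]
    have hr : ∀ m : ℕ, HasSum (fun n : ℕ => u ^ m / (m.factorial : ℝ) * ((n.choose m : ℝ) * y ^ n))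
      (u ^ m / (m.factorial : ℝ) * (y ^ m / (1 - y) ^ (m + 1))) := fun m =>
        (hasSum_choose_mul_pow m habs).mul_left _
    exact ⟨fun m => (hr m).summable, (hexp u).summable.congr fun m => (hr m).tsum_eq.symm⟩
  have h1 : HasSum f (Real.exp (-(y / (1 - y)) * u) / (1 - y)) := by
    have := hsum.hasSum.prod_fiberwise hrow
    rw [(by ring : -(y / (1 - y)) * u = y / (1 - y) * (-u)), ← this.unique (hexp (-u))]
    exact hsum.hasSum
  have h2 : HasSum (fun z : ℕ × ℕ => f z.swap) (Real.exp (-(y / (1 - y)) * u) / (1 - y)) :=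
    (Equiv.prodComm ℕ ℕ).hasSum_iff.2 h1
  refine h2.prod_fiberwise fun n => ?_
  have : y ^ n * laguerre n u = ∑ m ∈ Finset.range (n + 1), f (m, n) := by
    rw [laguerre, Finset.mul_sum]
    exact Finset.sum_congr rfl fun m _ => by simp only [f]; ring
  rw [this]
  refine hasSum_sum_of_ne_finset_zero fun m hm => ?_
  have : n < m := by simpa using hm
  simp [f, Nat.choose_eq_zero_of_lt this]

/-! ### Continuous counterparts as mixtures -/

/-- The continuous counterpart of the constant `m`. -/
def fockCounterpart (m : ℕ) : Measure ℂ :=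
  volume.withDensity fun r =>
    ENNReal.ofReal (Real.exp (-‖r‖ ^ 2) * ‖r‖ ^ (2 * m) / ((m.factorial : ℝ) * Real.pi))

theorem integral_norm_pow_mul_gaussian (m : ℕ) {a : ℝ} (ha : 0 < a) :
    ∫ r : ℂ, ‖r‖ ^ (2 * m) * Real.exp (-a * ‖r‖ ^ 2) =
      Real.pi * (m.factorial : ℝ) / a ^ (m + 1) := by
  have h := Complex.integral_rpow_mul_exp_neg_mul_rpow (p := 2) (q := ((2 * m : ℕ) : ℝ)) (b := a)
    (by norm_num) (by have : (0 : ℝ) ≤ ((2 * m : ℕ) : ℝ) := Nat.cast_nonneg _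
                      linarith) ha
  simp_rw [Real.rpow_natCast, Real.rpow_two] at h
  rw [h]
  have e1 : (((2 * m : ℕ) : ℝ) + 2) / 2 = (m : ℝ) + 1 := by push_cast; ring
  have e2 : -(((2 * m : ℕ) : ℝ) + 2) / 2 = -((m + 1 : ℕ) : ℝ) := by push_cast; ring
  rw [e1, e2, Real.Gamma_nat_eq_factorial, Real.rpow_neg ha.le, Real.rpow_natCast]
  ring

theorem integral_fockCounterpart (m : ℕ) {a : ℝ} (ha : 0 ≤ a) :
    ∫ r, Real.exp (-a * ‖r‖ ^ 2) ∂(fockCounterpart m) = 1 / (1 + a) ^ (m + 1) := by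
  rw [fockCounterpart, integral_withDensity_eq_integral_toReal_smul (by fun_prop)
    (Filter.Eventually.of_forall fun _ => ENNReal.ofReal_lt_top)]
  have : ∀ r : ℂ, (ENNReal.ofReal (Real.exp (-‖r‖ ^ 2) * ‖r‖ ^ (2 * m) /
      ((m.factorial : ℝ) * Real.pi))).toReal • Real.exp (-a * ‖r‖ ^ 2) =
      1 / ((m.factorial : ℝ) * Real.pi) * (‖r‖ ^ (2 * m) * Real.exp (-(1 + a) * ‖r‖ ^ 2)) := by
    intro r
    rw [ENNReal.toReal_ofReal (by positivity), smul_eq_mul,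
      (by ring : -(1 + a) * ‖r‖ ^ 2 = -‖r‖ ^ 2 + -a * ‖r‖ ^ 2), Real.exp_add]
    ring
  simp_rw [this]
  rw [integral_const_mul, integral_norm_pow_mul_gaussian m (by linarith)]
  have := Real.pi_pos
  field_simp

theorem isProbabilityMeasure_fockCounterpart (m : ℕ) :
    IsProbabilityMeasure (fockCounterpart m) := by
  constructor
  have h := integral_norm_pow_mul_gaussian m one_pos
  rw [fockCounterpart, withDensity_apply _ MeasurableSet.univ, Measure.restrict_univ]
  have hpi := Real.pi_pos
  have hi : ∫ r : ℂ, Real.exp (-‖r‖ ^ 2) * ‖r‖ ^ (2 * m) / ((m.factorial : ℝ) * Real.pi) = 1 := by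
    rw [integral_div]
    simp_rw [mul_comm (Real.exp _)]
    simp only [neg_mul, one_mul] at h
    rw [h]
    field_simp
    simp
  rw [← ofReal_integral_eq_lintegral_ofReal _ (Filter.Eventually.of_forall fun r => by positivity),
    hi, ENNReal.ofReal_one]
  -- What remains is integrability: a non-integrable function would have integral `0` by convention,
  -- not `1`.
  by_contra hc
  rw [integral_undef hc] at hi
  exact zero_ne_one hi

theorem summable_counterpartDensity {p : ℕ → ℝ} (hp : IsMassFunction p) (r : ℂ) :
    Summable fun n : ℕ =>
      p n * (Real.exp (-‖r‖ ^ 2) * ‖r‖ ^ (2 * n) / ((n.factorial : ℝ) * Real.pi)) := by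
  have hpi := Real.pi_pos
  refine Summable.of_nonneg_of_le
    (fun n => mul_nonneg (hp.nonneg n) (by positivity)) (fun n => ?_)
    (hp.hasSum.summable.mul_right (1 / Real.pi))
  have h := Real.pow_div_factorial_le_exp (‖r‖ ^ 2) (by positivity) n
  refine mul_le_mul_of_nonneg_left ?_ (hp.nonneg n)
  calc _ = Real.exp (-‖r‖ ^ 2) * ((‖r‖ ^ 2) ^ n / (n.factorial : ℝ)) * (1 / Real.pi) := by
        rw [pow_mul]; field_simp
    _ ≤ Real.exp (-‖r‖ ^ 2) * Real.exp (‖r‖ ^ 2) * (1 / Real.pi) := by gcongr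
    _ = _ := by rw [← Real.exp_add]; simp

/-- Viewing the counterpart as a mixture lets integrals against it be evaluated one integer at a
time. -/
theorem counterpart_eq_sum {p : ℕ → ℝ} (hp : IsMassFunction p) :
    counterpart p = Measure.sum fun m => ENNReal.ofReal (p m) • fockCounterpart m := by
  have hpi := Real.pi_pos
  have e : ∀ m, ENNReal.ofReal (p m) • fockCounterpart m =
      volume.withDensity (ENNReal.ofReal (p m) • fun r : ℂ =>
        ENNReal.ofReal (Real.exp (-‖r‖ ^ 2) * ‖r‖ ^ (2 * m) / ((m.factorial : ℝ) * Real.pi))) :=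
    fun m => (withDensity_smul _ (by fun_prop)).symm
  simp_rw [e]
  rw [counterpart, ← withDensity_tsum (fun i => by fun_prop)]
  congr 1
  ext r
  rw [counterpartDensity, ENNReal.ofReal_tsum_of_nonneg
    (fun n => mul_nonneg (hp.nonneg n) (by positivity)) (summable_counterpartDensity hp r),
    tsum_apply (Pi.summable.2 fun _ => ENNReal.summable)]
  refine tsum_congr fun n => ?_
  rw [ENNReal.ofReal_mul (hp.nonneg n)]
  rfl

theorem isProbabilityMeasure_counterpart {p : ℕ → ℝ} (hp : IsMassFunction p) :
    IsProbabilityMeasure (counterpart p) := by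
  constructor
  rw [counterpart_eq_sum hp, Measure.sum_apply _ MeasurableSet.univ]
  have : ∀ m, (ENNReal.ofReal (p m) • fockCounterpart m) Set.univ = ENNReal.ofReal (p m) := by
    intro m
    have := isProbabilityMeasure_fockCounterpart m
    simp
  simp_rw [this]
  rw [← ENNReal.ofReal_tsum_of_nonneg hp.nonneg hp.hasSum.summable, hp.hasSum.tsum_eq,
    ENNReal.ofReal_one]

theorem hasSum_integral_counterpart {p : ℕ → ℝ} (hp : IsMassFunction p) {a : ℝ} (ha : 0 ≤ a) :
    HasSum (fun m => p m * (1 / (1 + a) ^ (m + 1)))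
      (∫ r, Real.exp (-a * ‖r‖ ^ 2) ∂(counterpart p)) := by
  have := isProbabilityMeasure_counterpart hp
  have hint : Integrable (fun r : ℂ => Real.exp (-a * ‖r‖ ^ 2)) (counterpart p) := by
    refine Integrable.of_bound (by fun_prop) 1 (Filter.Eventually.of_forall fun r => ?_)
    rw [Real.norm_of_nonneg (Real.exp_nonneg _), Real.exp_le_one_iff]
    nlinarith [sq_nonneg ‖r‖]
  rw [counterpart_eq_sum hp] at hint ⊢
  have h := hasSum_integral_measure hint
  have e : (fun m => p m * (1 / (1 + a) ^ (m + 1))) = fun m =>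
      ∫ r, Real.exp (-a * ‖r‖ ^ 2) ∂(ENNReal.ofReal (p m) • fockCounterpart m) := by
    ext m
    rw [integral_smul_measure, integral_fockCounterpart m ha,
      ENNReal.toReal_ofReal (hp.nonneg m), smul_eq_mul]
  rw [e]
  exact h

/-! ### The generating function of the beamsplitter sum -/

theorem continuous_laguerre (n : ℕ) : Continuous (laguerre n) := by
  unfold laguerre
  fun_prop

theorem counterpartDensity_geometricMass {l : ℝ} (hl : 0 < l) (r : ℂ) :
    counterpartDensity (geometricMass l) r =
      1 / (Real.pi * (1 + l)) * Real.exp (-(1 / (1 + l)) * ‖r‖ ^ 2) := by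
  have hpi := Real.pi_pos
  have h := ((NormedSpace.expSeries_div_hasSum_exp (l / (1 + l) * ‖r‖ ^ 2)).mul_left
    (Real.exp (-‖r‖ ^ 2) / (Real.pi * (1 + l)))).tsum_eq
  rw [← Real.exp_eq_exp_ℝ] at h
  rw [counterpartDensity]
  calc _ = ∑' n : ℕ, Real.exp (-‖r‖ ^ 2) / (Real.pi * (1 + l)) *
        ((l / (1 + l) * ‖r‖ ^ 2) ^ n / (n.factorial : ℝ)) := by
        refine tsum_congr fun n => ?_
        rw [geometricMass, mul_pow, div_pow, pow_succ, pow_mul]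
        field_simp
    _ = _ := by
        rw [h, div_mul_eq_mul_div, ← Real.exp_add, div_eq_mul_inv, mul_comm, one_div]
        congr 2
        field_simp
        ring

theorem integral_character_counterpart_geometricMass {l : ℝ} (hl : 0 < l) (s : ℂ) :
    ∫ r, Complex.exp (r * (starRingEnd ℂ) s - (starRingEnd ℂ) r * s)
      ∂(counterpart (geometricMass l)) = (Real.exp (-(1 + l) * ‖s‖ ^ 2) : ℝ) := by
  have hpi := Real.pi_pos
  have hd : (fun r : ℂ => ENNReal.ofReal (counterpartDensity (geometricMass l) r)) = fun r =>
      ENNReal.ofReal (1 / (Real.pi * (1 + l)) * Real.exp (-(1 / (1 + l)) * ‖r‖ ^ 2)) := by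
    ext r
    rw [counterpartDensity_geometricMass hl]
  rw [counterpart, hd, integral_withDensity_eq_integral_toReal_smul (by fun_prop)
    (Filter.Eventually.of_forall fun _ => ENNReal.ofReal_lt_top)]
  have : ∀ r : ℂ, (ENNReal.ofReal (1 / (Real.pi * (1 + l)) *
      Real.exp (-(1 / (1 + l)) * ‖r‖ ^ 2))).toReal •
        Complex.exp (r * (starRingEnd ℂ) s - (starRingEnd ℂ) r * s) =
      ((1 / (Real.pi * (1 + l)) : ℝ) : ℂ) *
        (Complex.exp (r * (starRingEnd ℂ) s - (starRingEnd ℂ) r * s) *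
          (Real.exp (-(1 / (1 + l)) * ‖r‖ ^ 2) : ℂ)) := by
    intro r
    rw [ENNReal.toReal_ofReal (by positivity), Complex.real_smul, Complex.ofReal_mul]
    ring
  simp_rw [this]
  rw [integral_const_mul, integral_character_mul_gaussian (by positivity), ← mul_assoc,
    ← Complex.ofReal_mul]
  have e1 : 1 / (Real.pi * (1 + l)) * (Real.pi / (1 / (1 + l))) = 1 := by field_simp
  rw [e1, Complex.ofReal_one, one_mul]
  congr 2
  field_simp

theorem integral_character_scaledSum (t : ℝ) (μ ν : Measure ℂ) [IsFiniteMeasure μ]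
    [IsFiniteMeasure ν] (s : ℂ) :
    ∫ r, Complex.exp (r * (starRingEnd ℂ) s - (starRingEnd ℂ) r * s) ∂(scaledSum t μ ν) =
      (∫ r, Complex.exp ((Real.sqrt t * r) * (starRingEnd ℂ) s -
        (starRingEnd ℂ) (Real.sqrt t * r) * s) ∂μ) *
      ∫ r, Complex.exp ((Real.sqrt (1 - t) * r) * (starRingEnd ℂ) s -
        (starRingEnd ℂ) (Real.sqrt (1 - t) * r) * s) ∂ν := by
  rw [scaledSum, integral_map (by fun_prop) (by fun_prop), ← integral_prod_mul]
  congr 1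
  ext w
  rw [← Complex.exp_add]
  congr 1
  simp only [map_add, map_mul]
  ring

theorem character_smul (c : ℝ) (r s : ℂ) :
    Complex.exp (((c : ℂ) * r) * (starRingEnd ℂ) s - (starRingEnd ℂ) ((c : ℂ) * r) * s) =
      Complex.exp (r * (starRingEnd ℂ) ((c : ℂ) * s) - (starRingEnd ℂ) r * ((c : ℂ) * s)) := by
  congr 1
  simp only [map_mul, Complex.conj_ofReal]
  ring

theorem character_swap (r s : ℂ) :
    Complex.exp (s * (starRingEnd ℂ) r - (starRingEnd ℂ) s * r) =
      Complex.exp (r * (starRingEnd ℂ) (-s) - (starRingEnd ℂ) r * (-s)) := by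
  congr 1
  simp only [map_neg]
  ring

theorem integrable_exp_neg_mul_sq_norm {c : ℝ} (hc : 0 < c) :
    Integrable fun s : ℂ => Real.exp (-c * ‖s‖ ^ 2) := by
  by_contra h
  have h1 := GaussianFourier.integral_rexp_neg_mul_sq_norm (V := ℂ) hc
  rw [integral_undef h, Complex.finrank_real_complex] at h1
  have h2 : 0 < (Real.pi / c) ^ (((2 : ℕ) : ℝ) / 2) := by
    have := Real.pi_pos
    positivity
  exact h2.ne h1

/-- Gaussian averages of a characteristic function. -/
theorem integral_gaussian_mul_charFun (μ : Measure ℂ) [IsFiniteMeasure μ] {c : ℝ} (hc : 0 < c)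
    {t : ℝ} (ht : 0 ≤ t) :
    ∫ s : ℂ, (Real.exp (-c * ‖s‖ ^ 2) : ℂ) *
      ∫ r, Complex.exp ((Real.sqrt t * r) * (starRingEnd ℂ) s -
        (starRingEnd ℂ) (Real.sqrt t * r) * s) ∂μ =
      ((Real.pi / c * ∫ r, Real.exp (-(t / c) * ‖r‖ ^ 2) ∂μ : ℝ) : ℂ) := by
  have hg := integrable_exp_neg_mul_sq_norm hc
  simp_rw [← integral_const_mul]
  -- Fubini puts the Gaussian integral in `s` inside, where it is an explicit Fourier transform;
  -- unimodularity of the character justifies the swap.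
  rw [integral_integral_swap]
  · rw [← integral_complex_ofReal]
    congr 1
    ext r
    rw [Complex.ofReal_mul]
    have : ∀ s : ℂ, (Real.exp (-c * ‖s‖ ^ 2) : ℂ) *
        Complex.exp ((Real.sqrt t * r) * (starRingEnd ℂ) s -
          (starRingEnd ℂ) (Real.sqrt t * r) * s) =
        Complex.exp (s * (starRingEnd ℂ) (-(Real.sqrt t * r)) -
          (starRingEnd ℂ) s * (-(Real.sqrt t * r))) * (Real.exp (-c * ‖s‖ ^ 2) : ℂ) := by
      intro s
      rw [← character_swap, mul_comm]
    simp_rw [this]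
    rw [integral_character_mul_gaussian hc]
    congr 3
    rw [norm_neg, norm_mul, mul_pow, Complex.norm_real, Real.norm_of_nonneg (Real.sqrt_nonneg t),
      Real.sq_sqrt ht]
    ring
  · have hm : Integrable (fun z : ℂ × ℂ => (Real.exp (-c * ‖z.1‖ ^ 2)) * (1 : ℝ))
        (volume.prod μ) := hg.mul_prod (integrable_const 1)
    refine hm.mono' (by unfold Function.uncurry; fun_prop)
      (Filter.Eventually.of_forall fun z => ?_)
    simp only [Function.uncurry]
    rw [norm_mul, norm_character, Complex.norm_real, Real.norm_of_nonneg (Real.exp_nonneg _)]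

/-- The generating function of the beamsplitter sum with a geometric mass function. -/
theorem hasSum_beamsplitterAdd {p : ℕ → ℝ} (hp : IsMassFunction p) {l : ℝ} (hl : 0 < l)
    {t : ℝ} (ht : t ∈ Set.Ioo (0 : ℝ) 1) (hgeom : IsMassFunction (geometricMass l)) :
    ∃ δ > 0, ∀ y ∈ Set.Ioo (0 : ℝ) δ,
      HasSum (fun n => y ^ n * beamsplitterAdd t p (geometricMass l) n)
        (1 / (1 + (1 - t) * l * (1 - y)) * ∑' m, p m *
          ((1 + (1 - t) * l * (1 - y) - t * (1 - y)) / (1 + (1 - t) * l * (1 - y))) ^ m) := by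
  obtain ⟨ht0, ht1⟩ := ht
  have hμ := isProbabilityMeasure_counterpart hp
  have hν := isProbabilityMeasure_counterpart hgeom
  have hpi := Real.pi_pos
  have ht2 : 0 < 1 - t := by linarith
  -- The characteristic function of the scaled geometric counterpart is `exp (-β ‖s‖ ^ 2)`.
  set β : ℝ := (1 - t) * (1 + l) with hβdef
  have hβ : 0 < β := by positivity
  set φ : ℂ → ℂ := fun s => ∫ r, Complex.exp ((Real.sqrt t * r) * (starRingEnd ℂ) s -
        (starRingEnd ℂ) (Real.sqrt t * r) * s) ∂(counterpart p) with hφ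
  have hφ1 : ∀ s, ‖φ s‖ ≤ 1 := fun s => by
    refine (norm_integral_le_of_norm_le_const (C := 1)
      (Filter.Eventually.of_forall fun r => (norm_character _ _).le)).trans ?_
    simp
  have hφm : AEStronglyMeasurable φ volume := by
    refine Continuous.aestronglyMeasurable ?_
    refine continuous_of_dominated (bound := fun _ => 1) (fun s => by fun_prop)
      (fun s => Filter.Eventually.of_forall fun r => (norm_character _ _).le)
      (integrable_const 1) (Filter.Eventually.of_forall fun r => by fun_prop)
  have hchar : ∀ s, ∫ r, Complex.exp (r * (starRingEnd ℂ) s - (starRingEnd ℂ) r * s)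
      ∂(scaledSum t (counterpart p) (counterpart (geometricMass l))) =
      φ s * (Real.exp (-β * ‖s‖ ^ 2) : ℝ) := by
    intro s
    rw [integral_character_scaledSum]
    simp_rw [character_smul (Real.sqrt (1 - t))]
    rw [integral_character_counterpart_geometricMass hl, norm_mul, mul_pow, Complex.norm_real,
      Real.norm_of_nonneg (Real.sqrt_nonneg _), Real.sq_sqrt ht2.le]
    congr 3
    rw [hβdef]
    ring
  -- With `M = 2 / β` the Laguerre bound uses up half of the Gaussian decay. The radius then makes
  -- the geometric ratio `y * (1 + 2 / β)` less than `1 / 2`.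
  have hM : 0 < 2 / β := by positivity
  have hδ : 0 < 1 / (2 * (1 + 2 / β)) := by positivity
  refine ⟨1 / (2 * (1 + 2 / β)), hδ, fun y ⟨hy0, hy⟩ => ?_⟩
  have hy2 : y * (1 + 2 / β) < 1 / 2 := by
    rw [lt_div_iff₀ (by positivity)] at hy
    linarith
  have hy1 : y < 1 := by nlinarith
  have hy1' : 0 < 1 - y := by linarith
  set F : ℕ → ℂ → ℂ := fun n s => (y ^ n * laguerre n (‖s‖ ^ 2) : ℝ) *
    (φ s * (Real.exp (-β * ‖s‖ ^ 2) : ℝ)) with hF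
  have hFle : ∀ n s, ‖F n s‖ ≤ (y * (1 + 2 / β)) ^ n * Real.exp (-(β / 2) * ‖s‖ ^ 2) := by
    intro n s
    have hl := abs_laguerre_le (u := ‖s‖ ^ 2) (by positivity) hM n
    rw [hF]
    simp only
    rw [norm_mul, norm_mul, Complex.norm_real, Complex.norm_real, Real.norm_eq_abs, abs_mul,
      abs_of_nonneg (pow_nonneg hy0.le n), Real.norm_of_nonneg (Real.exp_nonneg _)]
    calc y ^ n * |laguerre n (‖s‖ ^ 2)| * (‖φ s‖ * Real.exp (-β * ‖s‖ ^ 2))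
        ≤ y ^ n * ((1 + 2 / β) ^ n * Real.exp (‖s‖ ^ 2 / (2 / β))) *
          (1 * Real.exp (-β * ‖s‖ ^ 2)) := by
          have := hφ1 s
          gcongr
      _ = (y * (1 + 2 / β)) ^ n *
          (Real.exp (‖s‖ ^ 2 / (2 / β)) * Real.exp (-β * ‖s‖ ^ 2)) := by
          rw [mul_pow]; ring
      _ = _ := by
          rw [← Real.exp_add]
          congr 2
          field_simp
          ring
  have hgi := integrable_exp_neg_mul_sq_norm (half_pos hβ)
  have hFm : ∀ n, AEStronglyMeasurable (F n) volume := fun n => by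
    have := continuous_laguerre n
    rw [hF]
    refine AEStronglyMeasurable.mul (by fun_prop) (hφm.mul (by fun_prop))
  have hFi : ∀ n, Integrable (F n) := fun n =>
    (hgi.const_mul _).mono' (hFm n) (Filter.Eventually.of_forall (hFle n))
  have hsn : Summable fun n => ∫ s, ‖F n s‖ := by
    refine Summable.of_nonneg_of_le (fun n => integral_nonneg fun s => norm_nonneg _) (fun n => ?_)
      ((summable_geometric_of_lt_one (by positivity) (hy2.trans (by norm_num))).mul_right
        (∫ s : ℂ, Real.exp (-(β / 2) * ‖s‖ ^ 2)))
    rw [← integral_const_mul]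
    exact integral_mono (hFi n).norm (hgi.const_mul _) (hFle n)
  have hsum := hasSum_integral_of_summable_integral_norm hFi hsn
  -- Total Gaussian exponent once the Laguerre series has been summed.
  set c : ℝ := β + y / (1 - y) with hc
  have hc0 : 0 < c := by positivity
  have hptw : ∀ s, ∑' n, F n s =
      ((1 / (1 - y) : ℝ) : ℂ) * ((Real.exp (-c * ‖s‖ ^ 2) : ℂ) * φ s) := by
    intro s
    have h := (Complex.hasSum_ofReal.2 (hasSum_pow_mul_laguerre (u := ‖s‖ ^ 2) (by positivity)
      hy0.le hy1)).mul_right (φ s * (Real.exp (-β * ‖s‖ ^ 2) : ℝ))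
    rw [hF, h.tsum_eq]
    have e : Real.exp (-c * ‖s‖ ^ 2) =
        Real.exp (-(y / (1 - y)) * ‖s‖ ^ 2) * Real.exp (-β * ‖s‖ ^ 2) := by
      rw [← Real.exp_add, hc]
      congr 1
      ring
    rw [e]
    push_cast
    ring
  simp_rw [hptw] at hsum
  rw [integral_const_mul, integral_gaussian_mul_charFun _ hc0 ht0.le,
    ← (hasSum_integral_counterpart hp (div_pos ht0 hc0).le).tsum_eq, ← Complex.ofReal_mul] at hsum
  have hsum2 := (Complex.hasSum_re (hsum.mul_left (1 / (Real.pi : ℂ))))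
  have hterm : ∀ n, y ^ n * beamsplitterAdd t p (geometricMass l) n =
      (1 / (Real.pi : ℂ) * ∫ s, F n s).re := by
    intro n
    rw [beamsplitterAdd, counterpartInv]
    simp_rw [integral_const_mul, hchar]
    rw [← Complex.re_ofReal_mul, mul_left_comm, ← integral_const_mul]
    congr 3
    ext s
    rw [hF]
    push_cast
    ring
  rw [← funext hterm] at hsum2
  convert hsum2 using 1
  rw [← Complex.ofReal_one, ← Complex.ofReal_div, ← Complex.ofReal_mul, Complex.ofReal_re,
    ← tsum_mul_left, ← tsum_mul_left, ← tsum_mul_left, ← tsum_mul_left]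
  refine tsum_congr fun m => ?_
  have hD : 1 + (1 - t) * l * (1 - y) = (1 - y) * (c + t) := by
    rw [hc, hβdef]; field_simp; ring
  have hN : 1 + (1 - t) * l * (1 - y) - t * (1 - y) = (1 - y) * c := by
    rw [hD]; ring
  have h1 : 1 + t / c = (c + t) / c := by field_simp
  rw [hN, hD, h1, mul_div_mul_left _ _ hy1'.ne', div_pow, div_pow, pow_succ, pow_succ]
  field_simp

/-! ### Thinning and amplification -/

/-- Tonelli for a non-negative kernel. It transfers total masses, moments and generating functions
from the kernels to the mixtures. -/
theorem hasSum_mixture {k : ℕ → ℕ → ℝ} {p w : ℕ → ℝ} {W : ℝ} (hk : ∀ m j, 0 ≤ k m j)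
    (hp : ∀ m, 0 ≤ p m) (h : ∀ m, HasSum (k m) (w m)) (hW : HasSum (fun m => w m * p m) W) :
    HasSum (fun j => ∑' m, k m j * p m) W := by
  have hrow : ∀ m, HasSum (fun j => k m j * p m) (w m * p m) := fun m => (h m).mul_right _
  have hs : Summable fun z : ℕ × ℕ => k z.1 z.2 * p z.1 := by
    rw [summable_prod_of_nonneg fun z => mul_nonneg (hk _ _) (hp _)]
    exact ⟨fun m => (hrow m).summable, hW.summable.congr fun m => (hrow m).tsum_eq.symm⟩
  have h1 : HasSum (fun z : ℕ × ℕ => k z.1 z.2 * p z.1) W := by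
    rw [← (hs.hasSum.prod_fiberwise hrow).unique hW]
    exact hs.hasSum
  have h2 : HasSum (fun z : ℕ × ℕ => k z.2 z.1 * p z.2) W :=
    (Equiv.prodComm ℕ ℕ).hasSum_iff.2 h1
  refine h2.prod_fiberwise fun j => ?_
  exact (h2.summable.prod_factor j).hasSum

/-- The difference is a power series whose zeros accumulate at the origin. A one-sided interval
suffices, since summability at `|z|` gives summability at `z`. -/
theorem eq_of_hasSum_pow_mul {a b : ℕ → ℝ} {f : ℝ → ℝ} {δ : ℝ} (hδ : 0 < δ)
    (ha : ∀ y ∈ Set.Ioo (0 : ℝ) δ, HasSum (fun n => y ^ n * a n) (f y))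
    (hb : ∀ y ∈ Set.Ioo (0 : ℝ) δ, HasSum (fun n => y ^ n * b n) (f y)) : a = b := by
  set c : ℕ → ℝ := fun n => a n - b n with hc
  have h0 : ∀ y ∈ Set.Ioo (0 : ℝ) δ, HasSum (fun n => y ^ n * c n) 0 := fun y hy => by
    have := (ha y hy).sub (hb y hy)
    simp_rw [sub_self, ← mul_sub] at this
    exact this
  have hs : ∀ᶠ z in nhds (0 : ℝ), Summable fun n => z ^ n * c n := by
    filter_upwards [Metric.ball_mem_nhds (0 : ℝ) hδ] with z hz
    rw [Metric.mem_ball, dist_zero_right, Real.norm_eq_abs] at hz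
    rcases eq_or_ne z 0 with rfl | hne
    · refine summable_of_ne_finset_zero (s := {0}) fun n hn => ?_
      rw [zero_pow (by simpa using hn), zero_mul]
    · refine (h0 |z| ⟨abs_pos.2 hne, hz⟩).summable.abs.of_norm_bounded fun n => ?_
      simp [abs_mul]
  have hps : HasFPowerSeriesAt (fun z => ∑' n, z ^ n * c n)
      (FormalMultilinearSeries.ofScalars ℝ c) 0 := by
    rw [hasFPowerSeriesAt_iff]
    filter_upwards [hs] with z hz
    simpa [FormalMultilinearSeries.coeff_ofScalars] using hz.hasSum
  have hzero : FormalMultilinearSeries.ofScalars ℝ c = 0 := by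
    by_contra hne
    have h1 := hps.locally_ne_zero hne
    have h2 : ∀ᶠ z in nhdsWithin (0 : ℝ) (Set.Ioi 0), (∑' n, z ^ n * c n) ≠ 0 :=
      h1.filter_mono (nhdsWithin_mono _ fun x (hx : 0 < x) => hx.ne')
    obtain ⟨z, hz, hz2⟩ := (h2.and (Ioo_mem_nhdsGT hδ)).exists
    exact hz (h0 z hz2).tsum_eq
  ext n
  have := FormalMultilinearSeries.coeff_ofScalars (𝕜 := ℝ) (p := c) (n := n)
  rw [hzero] at this
  have h3 : c n = 0 := this.symm
  rw [hc] at h3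
  linarith

/-- The binomial probability of `j` successes in `m` trials with success probability `r`. -/
def binomialMass (r : ℝ) (m j : ℕ) : ℝ := (m.choose j : ℝ) * r ^ j * (1 - r) ^ (m - j)

/-- Binomial thinning of a mass function. -/
def thinned (r : ℝ) (p : ℕ → ℝ) (j : ℕ) : ℝ := ∑' m, binomialMass r m j * p m

/-- The negative binomial probability that an amplifier with parameter `k` takes `j` to `n`. -/
def amplifierMass (k : ℝ) (j n : ℕ) : ℝ := (n.choose j : ℝ) * k ^ (n - j) * (1 - k) ^ (j + 1)

/-- Negative binomial amplification of a mass function. -/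
def amplified (k : ℝ) (u : ℕ → ℝ) (n : ℕ) : ℝ :=
  ∑ j ∈ Finset.range (n + 1), amplifierMass k j n * u j

theorem binomialMass_nonneg {r : ℝ} (h0 : 0 ≤ r) (h1 : r ≤ 1) (m j : ℕ) :
    0 ≤ binomialMass r m j := by
  have : 0 ≤ 1 - r := by linarith
  unfold binomialMass
  positivity

theorem binomialMass_of_lt {r : ℝ} {m j : ℕ} (h : m < j) : binomialMass r m j = 0 := by
  simp [binomialMass, Nat.choose_eq_zero_of_lt h]

theorem hasSum_binomialMass (r z : ℝ) (m : ℕ) :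
    HasSum (fun j => z ^ j * binomialMass r m j) ((1 - r + r * z) ^ m) := by
  have h : (1 - r + r * z) ^ m = ∑ j ∈ Finset.range (m + 1), z ^ j * binomialMass r m j := by
    rw [add_comm, add_pow]
    exact Finset.sum_congr rfl fun j _ => by rw [binomialMass, mul_pow]; ring
  rw [h]
  refine hasSum_sum_of_ne_finset_zero fun j hj => ?_
  rw [binomialMass_of_lt (by simpa using hj), mul_zero]

theorem hasSum_nat_mul_binomialMass (r : ℝ) (m : ℕ) :
    HasSum (fun j : ℕ => (j : ℝ) * binomialMass r m j) (r * m) := by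
  cases m with
  | zero =>
    have : (fun j : ℕ => (j : ℝ) * binomialMass r 0 j) = fun _ => 0 := by
      ext j
      cases j with
      | zero => simp
      | succ j => rw [binomialMass_of_lt (Nat.succ_pos j), mul_zero]
    rw [this]
    simp
  | succ m =>
    rw [← hasSum_nat_add_iff' 1]
    have h := (hasSum_binomialMass r 1 m).mul_left (r * (m + 1 : ℕ))
    have e : (fun j : ℕ => ((j + 1 : ℕ) : ℝ) * binomialMass r (m + 1) (j + 1)) =
        fun j => r * (m + 1 : ℕ) * (1 ^ j * binomialMass r m j) := by
      ext j
      have := Nat.add_one_mul_choose_eq m j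
      have h2 : ((m + 1 : ℕ) : ℝ) * (m.choose j : ℝ) =
        ((m + 1).choose (j + 1) : ℝ) * ((j + 1 : ℕ) : ℝ) := by exact_mod_cast this
      rw [binomialMass, binomialMass, one_pow, Nat.add_sub_add_right, pow_succ]
      linear_combination (-(r ^ j * r * (1 - r) ^ (m - j))) * h2
    simp only [Finset.range_one, Finset.sum_singleton, Nat.cast_zero, zero_mul, sub_zero]
    rw [e]
    simpa using h

theorem amplifierMass_nonneg {k : ℝ} (h0 : 0 ≤ k) (h1 : k ≤ 1) (j n : ℕ) :
    0 ≤ amplifierMass k j n := by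
  have : 0 ≤ 1 - k := by linarith
  unfold amplifierMass
  positivity

theorem amplifierMass_of_lt {k : ℝ} {j n : ℕ} (h : n < j) : amplifierMass k j n = 0 := by
  simp [amplifierMass, Nat.choose_eq_zero_of_lt h]

theorem hasSum_amplifierMass {k : ℝ} (h0 : 0 < k) (h1 : k < 1) {z : ℝ} (hz0 : 0 ≤ z) (hz1 : z ≤ 1)
    (j : ℕ) : HasSum (fun n => z ^ n * amplifierMass k j n)
      ((1 - k) / (1 - k * z) * (z * (1 - k) / (1 - k * z)) ^ j) := by
  have hkz : k * z < 1 := by nlinarith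
  have h := (hasSum_choose_mul_pow j (y := k * z)
    (by rwa [abs_of_nonneg (by positivity)])).mul_left ((1 - k) ^ (j + 1) / k ^ j)
  have e : (fun n => z ^ n * amplifierMass k j n) =
      fun n => (1 - k) ^ (j + 1) / k ^ j * ((n.choose j : ℝ) * (k * z) ^ n) := by
    ext n
    rcases lt_or_ge n j with hn | hn
    · rw [amplifierMass_of_lt hn, Nat.choose_eq_zero_of_lt hn]; simp
    · obtain ⟨i, rfl⟩ := Nat.exists_eq_add_of_le hn
      rw [amplifierMass, Nat.add_sub_cancel_left, mul_pow k z, pow_add k]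
      field_simp
  have e2 : (1 - k) / (1 - k * z) * (z * (1 - k) / (1 - k * z)) ^ j =
      (1 - k) ^ (j + 1) / k ^ j * ((k * z) ^ j / (1 - k * z) ^ (j + 1)) := by
    have : 1 - k * z ≠ 0 := by linarith
    rw [div_pow, mul_pow, mul_pow, pow_succ, pow_succ]
    field_simp
  rw [e, e2]
  exact h

/-- The identity `(n + 1) C(n, j) = (j + 1) C(n + 1, j + 1)` trades the weight `n + 1` for a shift
of both indices, reducing the moment to a total mass. -/
theorem hasSum_succ_mul_amplifierMass {k : ℝ} (h0 : 0 < k) (h1 : k < 1) (j : ℕ) :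
    HasSum (fun n : ℕ => ((n : ℝ) + 1) * amplifierMass k j n) (((j : ℝ) + 1) / (1 - k)) := by
  have h := (hasSum_amplifierMass h0 h1 zero_le_one le_rfl (j + 1)).mul_left
    (((j : ℝ) + 1) / (1 - k))
  have h1k : 1 - k ≠ 0 := by linarith
  simp only [mul_one, one_mul, div_self h1k, one_pow] at h
  rw [← hasSum_nat_add_iff' 1] at h
  simp only [Finset.range_one, Finset.sum_singleton, amplifierMass_of_lt (Nat.succ_pos j),
    mul_zero, sub_zero] at h
  have e : (fun n : ℕ => ((n : ℝ) + 1) * amplifierMass k j n) = fun n : ℕ =>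
      ((j : ℝ) + 1) / (1 - k) * amplifierMass k (j + 1) (n + 1) := by
    ext n
    have h2 : ((n + 1 : ℕ) : ℝ) * (n.choose j : ℝ) =
        ((n + 1).choose (j + 1) : ℝ) * ((j + 1 : ℕ) : ℝ) := by
      exact_mod_cast Nat.add_one_mul_choose_eq n j
    push_cast at h2
    rw [amplifierMass, amplifierMass, Nat.add_sub_add_right, pow_succ _ (j + 1)]
    field_simp
    linear_combination h2
  rw [e]
  exact h

theorem amplified_eq_tsum (k : ℝ) (u : ℕ → ℝ) (n : ℕ) :
    amplified k u n = ∑' j, amplifierMass k j n * u j := by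
  rw [amplified, tsum_eq_sum]
  intro j hj
  rw [amplifierMass_of_lt (by simpa using hj), zero_mul]

theorem thinned_nonneg {r : ℝ} (h0 : 0 ≤ r) (h1 : r ≤ 1) {p : ℕ → ℝ} (hp : ∀ n, 0 ≤ p n) (j : ℕ) :
    0 ≤ thinned r p j :=
  tsum_nonneg fun m => mul_nonneg (binomialMass_nonneg h0 h1 m j) (hp m)

theorem amplified_nonneg {k : ℝ} (h0 : 0 ≤ k) (h1 : k ≤ 1) {u : ℕ → ℝ}
    (hu : ∀ n, 0 ≤ u n) (n : ℕ) : 0 ≤ amplified k u n :=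
  Finset.sum_nonneg fun j _ => mul_nonneg (amplifierMass_nonneg h0 h1 j n) (hu j)

theorem hasSum_pow_mul_thinned {r : ℝ} (h0 : 0 ≤ r) (h1 : r ≤ 1) {p : ℕ → ℝ}
    (hp : IsMassFunction p) {z : ℝ} (hz0 : 0 ≤ z) (hz1 : z ≤ 1) :
    HasSum (fun j => z ^ j * thinned r p j) (∑' m, (1 - r + r * z) ^ m * p m) := by
  have hw0 : 0 ≤ 1 - r + r * z := by nlinarith
  have hw1 : 1 - r + r * z ≤ 1 := by nlinarith
  have hs : Summable fun m => (1 - r + r * z) ^ m * p m :=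
    Summable.of_nonneg_of_le (fun m => mul_nonneg (pow_nonneg hw0 m) (hp.nonneg m))
      (fun m => mul_le_of_le_one_left (hp.nonneg m) (pow_le_one₀ hw0 hw1)) hp.hasSum.summable
  have h := hasSum_mixture (k := fun m j => z ^ j * binomialMass r m j) (p := p)
    (fun m j => mul_nonneg (pow_nonneg hz0 j) (binomialMass_nonneg h0 h1 m j)) hp.nonneg
    (hasSum_binomialMass r z) hs.hasSum
  simp_rw [mul_assoc, tsum_mul_left] at h
  exact h

theorem hasSum_pow_mul_amplified {k : ℝ} (h0 : 0 < k) (h1 : k < 1) {u : ℕ → ℝ}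
    (hu : IsMassFunction u) {z : ℝ} (hz0 : 0 ≤ z) (hz1 : z ≤ 1) :
    HasSum (fun n => z ^ n * amplified k u n)
      ((1 - k) / (1 - k * z) * ∑' j, (z * (1 - k) / (1 - k * z)) ^ j * u j) := by
  have hk : 0 < 1 - k := by linarith
  have hkz : 0 < 1 - k * z := by nlinarith
  have hw0 : 0 ≤ z * (1 - k) / (1 - k * z) := by positivity
  have hw1 : z * (1 - k) / (1 - k * z) ≤ 1 := by
    rw [div_le_one hkz]; nlinarith
  have hs : Summable fun m => (z * (1 - k) / (1 - k * z)) ^ m * u m :=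
    Summable.of_nonneg_of_le (fun m => mul_nonneg (pow_nonneg hw0 m) (hu.nonneg m))
      (fun m => mul_le_of_le_one_left (hu.nonneg m) (pow_le_one₀ hw0 hw1)) hu.hasSum.summable
  have h := hasSum_mixture (k := fun j n => z ^ n * amplifierMass k j n) (p := u)
    (fun j n => mul_nonneg (pow_nonneg hz0 n) (amplifierMass_nonneg h0.le h1.le j n)) hu.nonneg
    (hasSum_amplifierMass h0 h1 hz0 hz1)
    (W := (1 - k) / (1 - k * z) * ∑' j, (z * (1 - k) / (1 - k * z)) ^ j * u j)
    (by simpa only [mul_assoc] using hs.hasSum.mul_left _)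
  simp_rw [mul_assoc, tsum_mul_left, ← amplified_eq_tsum] at h
  simpa only [mul_assoc] using h

theorem isMassFunction_thinned {r : ℝ} (h0 : 0 ≤ r) (h1 : r ≤ 1) {p : ℕ → ℝ}
    (hp : IsMassFunction p) : IsMassFunction (thinned r p) := by
  refine ⟨thinned_nonneg h0 h1 hp.nonneg, ?_⟩
  simpa [hp.hasSum.tsum_eq] using hasSum_pow_mul_thinned h0 h1 hp zero_le_one le_rfl

theorem isMassFunction_amplified {k : ℝ} (h0 : 0 < k) (h1 : k < 1) {u : ℕ → ℝ}
    (hu : IsMassFunction u) : IsMassFunction (amplified k u) := by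
  refine ⟨amplified_nonneg h0.le h1.le hu.nonneg, ?_⟩
  have h1k : 1 - k ≠ 0 := by linarith
  simpa [hu.hasSum.tsum_eq, h1k] using hasSum_pow_mul_amplified h0 h1 hu zero_le_one le_rfl

theorem hasSum_nat_mul_thinned {r : ℝ} (h0 : 0 ≤ r) (h1 : r ≤ 1) {p : ℕ → ℝ} {a : ℝ}
    (hp : IsMassFunction p) (hm : HasSum (fun n : ℕ => (n : ℝ) * p n) a) :
    HasSum (fun n : ℕ => (n : ℝ) * thinned r p n) (r * a) := by
  have h := hasSum_mixture (k := fun m j => (j : ℝ) * binomialMass r m j) (p := p)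
    (fun m j => mul_nonneg j.cast_nonneg (binomialMass_nonneg h0 h1 m j)) hp.nonneg
    (hasSum_nat_mul_binomialMass r) (W := r * a) (by simpa only [mul_assoc] using hm.mul_left r)
  simp_rw [mul_assoc, tsum_mul_left] at h
  exact h

theorem hasSum_succ_mul_amplified {k : ℝ} (h0 : 0 < k) (h1 : k < 1) {u : ℕ → ℝ} {a : ℝ}
    (hu : IsMassFunction u) (hm : HasSum (fun n : ℕ => (n : ℝ) * u n) a) :
    HasSum (fun n : ℕ => ((n : ℝ) + 1) * amplified k u n) ((a + 1) / (1 - k)) := by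
  have hm1 : HasSum (fun n : ℕ => ((n : ℝ) + 1) / (1 - k) * u n) ((a + 1) / (1 - k)) := by
    have := (hm.add hu.hasSum).div_const (1 - k)
    have e : (fun n : ℕ => ((n : ℝ) + 1) / (1 - k) * u n) =
        fun n : ℕ => ((n : ℝ) * u n + u n) / (1 - k) := by ext n; ring
    rw [e]
    exact this
  have h := hasSum_mixture (k := fun j n => ((n : ℝ) + 1) * amplifierMass k j n) (p := u)
    (fun j n => mul_nonneg (by positivity) (amplifierMass_nonneg h0.le h1.le j n)) hu.nonneg
    (hasSum_succ_mul_amplifierMass h0 h1) hm1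
  simp_rw [mul_assoc, tsum_mul_left, ← amplified_eq_tsum] at h
  exact h

theorem isMassFunction_geometricMass {l : ℝ} (hl : 0 < l) : IsMassFunction (geometricMass l) := by
  refine ⟨fun n => by unfold geometricMass; positivity, ?_⟩
  have h := (hasSum_geometric_of_lt_one (r := l / (1 + l)) (by positivity)
    (by rw [div_lt_one (by positivity)]; linarith)).mul_left (1 / (1 + l))
  have e : geometricMass l = fun n => 1 / (1 + l) * (l / (1 + l)) ^ n := by
    ext n
    rw [geometricMass, div_pow, pow_succ]
    field_simp
  have e2 : 1 / (1 + l) * (1 - l / (1 + l))⁻¹ = 1 := by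
    have : 1 - l / (1 + l) = 1 / (1 + l) := by field_simp; ring
    rw [this]
    field_simp
  rw [e]
  rw [e2] at h
  exact h

/-- Thinning followed by amplification realises the beamsplitter sum with a geometric variable. -/
theorem beamsplitterAdd_eq_amplified_thinned {p : ℕ → ℝ} (hp : IsMassFunction p) {l : ℝ}
    (hl : 0 < l) {t : ℝ} (ht : t ∈ Set.Ioo (0 : ℝ) 1) :
    beamsplitterAdd t p (geometricMass l) =
      amplified ((1 - t) * l / (1 + (1 - t) * l)) (thinned (t / (1 + (1 - t) * l)) p) := by
  obtain ⟨δ, hδ, h⟩ := hasSum_beamsplitterAdd hp hl ht (isMassFunction_geometricMass hl)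
  obtain ⟨ht0, ht1⟩ := ht
  have hb : 0 < (1 - t) * l := mul_pos (by linarith) hl
  set b := (1 - t) * l
  have hk0 : 0 < b / (1 + b) := by positivity
  have hk1 : b / (1 + b) < 1 := by rw [div_lt_one (by positivity)]; linarith
  have hr0 : 0 ≤ t / (1 + b) := by positivity
  have hr1 : t / (1 + b) ≤ 1 := by rw [div_le_one (by positivity)]; linarith
  refine eq_of_hasSum_pow_mul (lt_min hδ one_pos)
    (fun y hy => h y ⟨hy.1, hy.2.trans_le (min_le_left _ _)⟩) fun y ⟨hy0, hy⟩ => ?_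
  have hy1 : y < 1 := hy.trans_le (min_le_right _ _)
  have hk := hasSum_pow_mul_amplified hk0 hk1 (isMassFunction_thinned hr0 hr1 hp) hy0.le hy1.le
  have hD : 0 < 1 + b * (1 - y) := by nlinarith
  have e1 : 1 - b / (1 + b) * y = (1 + b * (1 - y)) / (1 + b) := by field_simp; ring
  have e2 : 1 - b / (1 + b) = 1 / (1 + b) := by field_simp; ring
  have e3 : y * (1 / (1 + b)) / ((1 + b * (1 - y)) / (1 + b)) = y / (1 + b * (1 - y)) := by
    field_simp
  have e4 : 1 / (1 + b) / ((1 + b * (1 - y)) / (1 + b)) = 1 / (1 + b * (1 - y)) := by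
    field_simp
  rw [e1, e2, e3, e4, (hasSum_pow_mul_thinned hr0 hr1 hp (by positivity)
    (by rw [div_le_one hD]; nlinarith)).tsum_eq] at hk
  -- The amplifier acts on the argument of the generating function by a Möbius map and thinning by
  -- an affine one; their composite is the argument found for the beamsplitter sum.
  have e5 : 1 - t / (1 + b) + t / (1 + b) * (y / (1 + b * (1 - y))) =
      (1 + b * (1 - y) - t * (1 - y)) / (1 + b * (1 - y)) := by
    field_simp
    ring
  rw [e5] at hk
  simp_rw [mul_comm (p _)]
  exact hk

/-! ### Bounds on ratios of successive masses -/

theorem binomialMass_le_one {r : ℝ} (h0 : 0 ≤ r) (h1 : r ≤ 1) (m j : ℕ) :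
    binomialMass r m j ≤ 1 := by
  have h := hasSum_binomialMass r 1 m
  simp only [one_pow, one_mul, mul_one, sub_add_cancel] at h
  exact le_hasSum h j fun i _ => binomialMass_nonneg h0 h1 m i

theorem summable_binomialMass_mul {r : ℝ} (h0 : 0 ≤ r) (h1 : r ≤ 1) {p : ℕ → ℝ}
    (hp : IsMassFunction p) (j : ℕ) : Summable fun m => binomialMass r m j * p m := by
  refine Summable.of_nonneg_of_le
    (fun m => mul_nonneg (binomialMass_nonneg h0 h1 m j) (hp.nonneg m))
    (fun m => mul_le_of_le_one_left (hp.nonneg m) (binomialMass_le_one h0 h1 m j))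
    hp.hasSum.summable

theorem amplifierMass_zero_succ (k : ℝ) (n : ℕ) :
    amplifierMass k 0 (n + 1) = k * amplifierMass k 0 n := by
  simp [amplifierMass, pow_succ]
  ring

theorem amplifierMass_succ_succ (k : ℝ) (i n : ℕ) :
    amplifierMass k (i + 1) (n + 1) =
      k * amplifierMass k (i + 1) n + (1 - k) * amplifierMass k i n := by
  simp only [amplifierMass, Nat.add_sub_add_right, Nat.choose_succ_succ, Nat.cast_add]
  rcases lt_or_ge n (i + 1) with h | h
  · rw [Nat.choose_eq_zero_of_lt h]
    push_cast
    ring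
  · obtain ⟨d, rfl⟩ := Nat.exists_eq_add_of_le h
    rw [Nat.add_sub_cancel_left, show i + 1 + d - i = d + 1 by omega]
    ring

theorem amplified_eq_sum_succ_add (k : ℝ) (u : ℕ → ℝ) (n : ℕ) :
    amplified k u n = ∑ i ∈ Finset.range (n + 1), amplifierMass k (i + 1) n * u (i + 1) +
      amplifierMass k 0 n * u 0 := by
  rw [amplified, ← Finset.sum_range_succ' (fun j => amplifierMass k j n * u j),
    Finset.sum_range_succ _ (n + 1), amplifierMass_of_lt (Nat.lt_succ_self n), zero_mul, add_zero]

theorem amplified_succ (k : ℝ) (u : ℕ → ℝ) (n : ℕ) :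
    amplified k u (n + 1) = k * amplified k u n +
      (1 - k) * ∑ i ∈ Finset.range (n + 1), amplifierMass k i n * u (i + 1) := by
  rw [amplified_eq_sum_succ_add k u n, amplified, Finset.sum_range_succ', amplifierMass_zero_succ]
  simp_rw [amplifierMass_succ_succ, add_mul, Finset.sum_add_distrib, mul_add, Finset.mul_sum,
    mul_assoc]
  ring

theorem mul_amplified_le_amplified_succ {k : ℝ} (h0 : 0 ≤ k) (h1 : k ≤ 1) {u : ℕ → ℝ}
    (hu : ∀ n, 0 ≤ u n) (n : ℕ) : k * amplified k u n ≤ amplified k u (n + 1) := by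
  rw [amplified_succ]
  have : 0 ≤ ∑ i ∈ Finset.range (n + 1), amplifierMass k i n * u (i + 1) :=
    Finset.sum_nonneg fun i _ => mul_nonneg (amplifierMass_nonneg h0 h1 i n) (hu _)
  nlinarith

theorem pow_mul_amplified_zero_le {k : ℝ} (h0 : 0 ≤ k) (h1 : k ≤ 1) {u : ℕ → ℝ}
    (hu : ∀ n, 0 ≤ u n) (n : ℕ) : k ^ n * amplified k u 0 ≤ amplified k u n := by
  induction n with
  | zero => simp
  | succ n ih =>
    refine le_trans ?_ (mul_amplified_le_amplified_succ h0 h1 hu n)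
    rw [pow_succ', mul_assoc]
    exact mul_le_mul_of_nonneg_left ih h0

/-- Successive binomial masses have ratio `(m - i) / (i + 1) * r / (1 - r)`, which is controlled
while `m ≤ A (i + 1)`. For larger `m`, a Chernoff bound from the generating function at `1 / 2`
makes the mass itself exponentially small. -/
theorem binomialMass_succ_le {r k : ℝ} (h0 : 0 < r) (h1 : r < 1) (hk : 0 ≤ k) {A : ℕ}
    (hA : 2 * (1 - r / 2) ^ A ≤ k) (m i : ℕ) :
    binomialMass r m (i + 1) ≤ A * (r / (1 - r)) * binomialMass r m i + k ^ (i + 1) := by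
  have h1r : 0 < 1 - r := by linarith
  have hb := binomialMass_nonneg h0.le h1.le m i
  rcases le_total m (A * (i + 1)) with hm | hm
  · have h : binomialMass r m (i + 1) ≤ A * (r / (1 - r)) * binomialMass r m i := by
      rcases lt_or_ge m (i + 1) with hlt | hge
      · rw [binomialMass_of_lt hlt]
        positivity
      · obtain ⟨d, rfl⟩ := Nat.exists_eq_add_of_le hge
        have hc : ((i + 1 + d).choose (i + 1) : ℝ) ≤ A * ((i + 1 + d).choose i : ℝ) := by
          have := Nat.choose_succ_right_eq (i + 1 + d) i
          have h2 : (i + 1 + d).choose (i + 1) * (i + 1) ≤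
              (A * (i + 1 + d).choose i) * (i + 1) := by
            rw [this]
            calc (i + 1 + d).choose i * (i + 1 + d - i) ≤ (i + 1 + d).choose i * (A * (i + 1)) :=
                  Nat.mul_le_mul_left _ ((Nat.sub_le _ _).trans hm)
              _ = _ := by ring
          exact_mod_cast Nat.le_of_mul_le_mul_right h2 (Nat.succ_pos i)
        rw [binomialMass, binomialMass, Nat.add_sub_cancel_left,
          show i + 1 + d - i = d + 1 by omega]
        calc ((i + 1 + d).choose (i + 1) : ℝ) * r ^ (i + 1) * (1 - r) ^ d
            ≤ A * ((i + 1 + d).choose i : ℝ) * r ^ (i + 1) * (1 - r) ^ d := by gcongr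
          _ = _ := by
            rw [pow_succ, pow_succ]
            field_simp
    have := pow_nonneg hk (i + 1)
    linarith
  · have h := hasSum_binomialMass r (1 / 2) m
    have h2 := le_hasSum h (i + 1) fun j _ =>
      mul_nonneg (by positivity) (binomialMass_nonneg h0.le h1.le m j)
    have e : 1 - r + r * (1 / 2) = 1 - r / 2 := by ring
    rw [e] at h2
    have h3 : binomialMass r m (i + 1) ≤ 2 ^ (i + 1) * (1 - r / 2) ^ m := by
      calc binomialMass r m (i + 1)
          = 2 ^ (i + 1) * ((1 / 2) ^ (i + 1) * binomialMass r m (i + 1)) := by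
            rw [← mul_assoc, ← mul_pow]; norm_num
        _ ≤ _ := by gcongr
    have h4 : (1 - r / 2) ^ m ≤ (1 - r / 2) ^ (A * (i + 1)) :=
      pow_le_pow_of_le_one (by linarith) (by linarith) hm
    have h5 : 0 ≤ 1 - r / 2 := by linarith
    calc binomialMass r m (i + 1) ≤ 2 ^ (i + 1) * (1 - r / 2) ^ m := h3
      _ ≤ 2 ^ (i + 1) * (1 - r / 2) ^ (A * (i + 1)) := by gcongr
      _ = (2 * (1 - r / 2) ^ A) ^ (i + 1) := by rw [mul_pow, pow_mul]
      _ ≤ k ^ (i + 1) := by gcongr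
      _ ≤ _ := le_add_of_nonneg_left (by positivity)

theorem thinned_succ_le {r k : ℝ} (h0 : 0 < r) (h1 : r < 1) (hk : 0 ≤ k) {A : ℕ}
    (hA : 2 * (1 - r / 2) ^ A ≤ k) {p : ℕ → ℝ} (hp : IsMassFunction p) (i : ℕ) :
    thinned r p (i + 1) ≤ A * (r / (1 - r)) * thinned r p i + k ^ (i + 1) := by
  have hs := ((summable_binomialMass_mul h0.le h1.le hp i).hasSum.mul_left (A * (r / (1 - r)))).add
    (hp.hasSum.mul_left (k ^ (i + 1)))
  rw [mul_one] at hs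
  refine hasSum_le (fun m => ?_) (summable_binomialMass_mul h0.le h1.le hp (i + 1)).hasSum hs
  have := mul_le_mul_of_nonneg_right (binomialMass_succ_le h0 h1 hk hA m i) (hp.nonneg m)
  linarith

theorem sum_amplifierMass (k : ℝ) (n : ℕ) :
    ∑ i ∈ Finset.range (n + 1), amplifierMass k i n = 1 - k := by
  have h := add_pow (1 - k) k n
  rw [sub_add_cancel, one_pow] at h
  have h2 := congrArg (fun x => (1 - k) * x) h
  simp only [mul_one, Finset.mul_sum] at h2
  refine Eq.trans ?_ h2.symm
  exact Finset.sum_congr rfl fun i _ => by rw [amplifierMass, pow_succ]; ring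

theorem mul_amplifierMass_le {k : ℝ} (h0 : 0 ≤ k) (h1 : k ≤ 1) {i n : ℕ} (h : 2 * (i + 1) ≤ n) :
    (1 - k) * amplifierMass k i n ≤ amplifierMass k (i + 1) n := by
  have hc : (n.choose i : ℝ) ≤ n.choose (i + 1) := by
    exact_mod_cast Nat.choose_le_succ_of_lt_half_left (by omega)
  have h1k : 0 ≤ 1 - k := by linarith
  rw [amplifierMass, amplifierMass]
  calc (1 - k) * ((n.choose i : ℝ) * k ^ (n - i) * (1 - k) ^ (i + 1))
      = (n.choose i : ℝ) * k ^ (n - i) * (1 - k) ^ (i + 1 + 1) := by ring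
    _ ≤ (n.choose (i + 1) : ℝ) * k ^ (n - (i + 1)) * (1 - k) ^ (i + 1 + 1) := by
      have := pow_le_pow_of_le_one h0 h1 (show n - (i + 1) ≤ n - i by omega)
      gcongr

/-- In Pascal's recursion, terms with `2 (i + 1) ≤ n` are dominated by shifted terms of the same
sum, since binomial coefficients increase up to the middle. The others use the hypothesis on `u`;
there `2 (i + 1) > n`, so an error decaying like powers of `k ^ 2` is at most `k ^ n`. -/
theorem amplified_succ_le {k C : ℝ} (h0 : 0 ≤ k) (h1 : k ≤ 1) (hC : 0 ≤ C) {u : ℕ → ℝ}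
    (hu : ∀ n, 0 ≤ u n) (h : ∀ i, u (i + 1) ≤ C * u i + (k ^ 2) ^ (i + 1)) (n : ℕ) :
    amplified k u (n + 1) ≤ (2 + C) * amplified k u n + k ^ n := by
  have h1k : 0 ≤ 1 - k := by linarith
  have hP := amplified_nonneg h0 h1 hu n
  have hterm : ∀ i ∈ Finset.range (n + 1), (1 - k) * (amplifierMass k i n * u (i + 1)) ≤
      amplifierMass k (i + 1) n * u (i + 1) + C * (amplifierMass k i n * u i) +
        k ^ n * amplifierMass k i n := by
    intro i _
    have ha := amplifierMass_nonneg h0 h1 i n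
    have hb := amplifierMass_nonneg h0 h1 (i + 1) n
    have hki : 0 ≤ k ^ n := pow_nonneg h0 n
    have hui := hu i
    have hui1 := hu (i + 1)
    rcases le_or_gt (2 * (i + 1)) n with hi | hi
    · have := mul_le_mul_of_nonneg_right (mul_amplifierMass_le h0 h1 hi) hui1
      have h3 : 0 ≤ C * (amplifierMass k i n * u i) + k ^ n * amplifierMass k i n := by positivity
      linarith
    · have hk : (k ^ 2) ^ (i + 1) ≤ k ^ n := by
        rw [← pow_mul]
        exact pow_le_pow_of_le_one h0 h1 hi.le
      have h3 : u (i + 1) ≤ C * u i + k ^ n := (h i).trans (by linarith)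
      have h4 := mul_le_mul_of_nonneg_left h3 ha
      have h5 : (1 - k) * (amplifierMass k i n * u (i + 1)) ≤ amplifierMass k i n * u (i + 1) :=
        mul_le_of_le_one_left (by positivity) (by linarith)
      have h6 : 0 ≤ amplifierMass k (i + 1) n * u (i + 1) := by positivity
      linarith
  have hsum := Finset.sum_le_sum hterm
  rw [Finset.sum_add_distrib, Finset.sum_add_distrib, ← Finset.mul_sum, ← Finset.mul_sum,
    ← Finset.mul_sum, sum_amplifierMass] at hsum
  have hshift : ∑ i ∈ Finset.range (n + 1), amplifierMass k (i + 1) n * u (i + 1) ≤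
      amplified k u n := by
    rw [amplified_eq_sum_succ_add]
    exact le_add_of_nonneg_right (mul_nonneg (amplifierMass_nonneg h0 h1 0 n) (hu 0))
  have hkn : k ^ n * (1 - k) ≤ k ^ n := mul_le_of_le_one_right (pow_nonneg h0 n) (by linarith)
  have hkP : k * amplified k u n ≤ amplified k u n := mul_le_of_le_one_left hP h1
  have eP : ∑ i ∈ Finset.range (n + 1), amplifierMass k i n * u i = amplified k u n := rfl
  rw [eP] at hsum
  rw [amplified_succ]
  linarith

/-- The mass function of the beamsplitter sum of `p` and a geometric mass function of mean `l`,
written as thinning followed by amplification. -/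
def attenuated (p : ℕ → ℝ) (l t : ℝ) : ℕ → ℝ :=
  amplified ((1 - t) * l / (1 + (1 - t) * l)) (thinned (t / (1 + (1 - t) * l)) p)

theorem attenuated_params {l t : ℝ} (hl : 0 < l) (ht : t ∈ Set.Ioo (0 : ℝ) 1) :
    0 < (1 - t) * l ∧ (1 - t) * l / (1 + (1 - t) * l) ∈ Set.Ioo (0 : ℝ) 1 ∧
      t / (1 + (1 - t) * l) ∈ Set.Ioo (0 : ℝ) 1 := by
  obtain ⟨ht0, ht1⟩ := ht
  have hb : 0 < (1 - t) * l := mul_pos (by linarith) hl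
  refine ⟨hb, ⟨by positivity, ?_⟩, ⟨by positivity, ?_⟩⟩
  · rw [div_lt_one (by positivity)]; linarith
  · rw [div_lt_one (by positivity)]; linarith

theorem isMassFunction_attenuated {p : ℕ → ℝ} (hp : IsMassFunction p) {l t : ℝ} (hl : 0 < l)
    (ht : t ∈ Set.Ioo (0 : ℝ) 1) : IsMassFunction (attenuated p l t) := by
  obtain ⟨-, hk, hr⟩ := attenuated_params hl ht
  exact isMassFunction_amplified hk.1 hk.2 (isMassFunction_thinned hr.1.le hr.2.le hp)

theorem hasSum_succ_mul_attenuated {p : ℕ → ℝ} (hp : IsMassFunction p) {a : ℝ}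
    (hm : HasSum (fun n : ℕ => (n : ℝ) * p n) a) {l t : ℝ} (hl : 0 < l)
    (ht : t ∈ Set.Ioo (0 : ℝ) 1) :
    HasSum (fun n : ℕ => ((n : ℝ) + 1) * attenuated p l t n) (1 + (t * a + (1 - t) * l)) := by
  obtain ⟨hb, hk, hr⟩ := attenuated_params hl ht
  have h := hasSum_succ_mul_amplified hk.1 hk.2 (isMassFunction_thinned hr.1.le hr.2.le hp)
    (hasSum_nat_mul_thinned hr.1.le hr.2.le hp hm)
  have e : (t / (1 + (1 - t) * l) * a + 1) / (1 - (1 - t) * l / (1 + (1 - t) * l)) =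
      1 + (t * a + (1 - t) * l) := by
    have : 1 - (1 - t) * l / (1 + (1 - t) * l) = 1 / (1 + (1 - t) * l) := by
      field_simp; ring
    rw [this]
    field_simp
    ring
  rw [e] at h
  exact h

theorem attenuated_bounds {p : ℕ → ℝ} (hp : IsMassFunction p) {l : ℝ} (hl : 0 < l) {t₁ t₂ : ℝ}
    (h₁ : 0 < t₁) (h₂ : t₂ < 1) : ∃ a > 0, ∃ c > 0, ∃ C, ∀ t ∈ Set.Icc t₁ t₂,
      a ≤ attenuated p l t 0 ∧ ∀ n, c * attenuated p l t n ≤ attenuated p l t (n + 1) ∧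
        attenuated p l t (n + 1) ≤ C * attenuated p l t n := by
  rcases lt_or_ge t₂ t₁ with hlt | hle
  · exact ⟨1, one_pos, 1, one_pos, 0, fun t ht => absurd (ht.1.trans ht.2) hlt.not_ge⟩
  have h20 : 0 < 1 - t₂ := by linarith
  have hsτ : Summable fun m => (1 - t₂) ^ m * p m :=
    Summable.of_nonneg_of_le (fun m => mul_nonneg (by positivity) (hp.nonneg m))
      (fun m => mul_le_of_le_one_left (hp.nonneg m) (pow_le_one₀ h20.le (by linarith)))
      hp.hasSum.summable
  have hτ : 0 < ∑' m, (1 - t₂) ^ m * p m := by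
    obtain ⟨m, hm⟩ : ∃ m, p m ≠ 0 := by
      by_contra! hne
      have := hp.hasSum
      rw [funext hne] at this
      exact one_ne_zero (this.unique hasSum_zero)
    exact hsτ.tsum_pos (fun m => mul_nonneg (by positivity) (hp.nonneg m)) m
      (mul_pos (by positivity) ((hp.nonneg m).lt_of_ne' hm))
  -- The thinning parameter never exceeds `t₂`, so `τ` bounds the thinned mass at `0` from below.
  set τ := ∑' m, (1 - t₂) ^ m * p m
  set k₁ : ℝ := (1 - t₂) * l / (1 + l) with hk₁
  have hk₁0 : 0 < k₁ := by positivity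
  set r₁ : ℝ := t₁ / (1 + l) with hr₁
  have hr₁0 : 0 < r₁ := by positivity
  have hr₁1 : r₁ < 1 := by rw [hr₁, div_lt_one (by positivity)]; linarith
  -- Since `k₁` and `r₁` are lower bounds for the amplifier and thinning parameters, one `A` makes
  -- `2 (1 - r / 2) ^ A ≤ k ^ 2` hold for all `t` at once.
  obtain ⟨A, hA⟩ := exists_pow_lt_of_lt_one (show 0 < k₁ ^ 2 / 2 by positivity)
    (show 1 - r₁ / 2 < 1 by linarith)
  have ha : 0 < τ / (1 + l) := by positivity
  refine ⟨τ / (1 + l), ha, k₁, hk₁0, 2 + A * (t₂ / (1 - t₂)) + (τ / (1 + l))⁻¹, fun t ht => ?_⟩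
  have ht' : t ∈ Set.Ioo (0 : ℝ) 1 := ⟨h₁.trans_le ht.1, ht.2.trans_lt h₂⟩
  obtain ⟨hb, hk, hr⟩ := attenuated_params hl ht'
  have hbl : (1 - t) * l ≤ l := mul_le_of_le_one_left hl.le (by linarith [ht'.1])
  have hkk : k₁ ≤ (1 - t) * l / (1 + (1 - t) * l) := by
    rw [hk₁]
    have := ht.2
    gcongr
  have hrr : r₁ ≤ t / (1 + (1 - t) * l) := by
    rw [hr₁]
    have := ht.1
    have := ht'.1
    gcongr
  have hrt : t / (1 + (1 - t) * l) ≤ t₂ :=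
    (div_le_self ht'.1.le (by linarith)).trans ht.2
  have h1k : 1 / (1 + l) ≤ 1 - (1 - t) * l / (1 + (1 - t) * l) := by
    have : 1 - (1 - t) * l / (1 + (1 - t) * l) = 1 / (1 + (1 - t) * l) := by field_simp; ring
    rw [this]
    gcongr
  have hP : attenuated p l t = amplified ((1 - t) * l / (1 + (1 - t) * l))
    (thinned (t / (1 + (1 - t) * l)) p) := rfl
  rw [hP]
  set k := (1 - t) * l / (1 + (1 - t) * l)
  set r := t / (1 + (1 - t) * l)
  have hu := thinned_nonneg hr.1.le hr.2.le hp.nonneg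
  have hτu : τ ≤ thinned r p 0 := by
    refine hsτ.tsum_le_tsum (fun m => ?_) (summable_binomialMass_mul hr.1.le hr.2.le hp 0)
    refine mul_le_mul_of_nonneg_right ?_ (hp.nonneg m)
    simp only [binomialMass, Nat.choose_zero_right, Nat.cast_one, pow_zero, mul_one, one_mul,
      Nat.sub_zero]
    gcongr
  have hP0 : τ / (1 + l) ≤ amplified k (thinned r p) 0 := by
    have e : amplified k (thinned r p) 0 = (1 - k) * thinned r p 0 := by
      simp [amplified, amplifierMass]
    rw [e, div_eq_mul_one_div, mul_comm]
    exact mul_le_mul h1k hτu hτ.le (by linarith [hk.2])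
  refine ⟨hP0, fun n => ⟨?_, ?_⟩⟩
  · refine le_trans ?_ (mul_amplified_le_amplified_succ hk.1.le hk.2.le hu n)
    exact mul_le_mul_of_nonneg_right hkk (amplified_nonneg hk.1.le hk.2.le hu n)
  · have hAk : 2 * (1 - r / 2) ^ A ≤ k ^ 2 := by
      have h3 : (1 - r / 2) ^ A ≤ (1 - r₁ / 2) ^ A :=
        pow_le_pow_left₀ (by linarith [hr.2]) (by linarith) A
      have h4 : k₁ ^ 2 ≤ k ^ 2 := by gcongr
      linarith
    have h1r : 0 < 1 - r := by linarith [hr.2]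
    have hC : (A : ℝ) * (r / (1 - r)) ≤ A * (t₂ / (1 - t₂)) := by
      have := h₁.trans_le hle
      gcongr
    have hCn : 0 ≤ (A : ℝ) * (r / (1 - r)) := mul_nonneg A.cast_nonneg (div_nonneg hr.1.le h1r.le)
    have h5 := amplified_succ_le hk.1.le hk.2.le hCn hu
      (thinned_succ_le hr.1 hr.2 (sq_nonneg k) hAk hp) n
    have hPn := amplified_nonneg hk.1.le hk.2.le hu n
    -- The additive error is absorbed because amplified masses decay no faster than `k ^ n` times
    -- the mass at `0`.
    have h6 : k ^ n ≤ (τ / (1 + l))⁻¹ * amplified k (thinned r p) n := by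
      rw [inv_mul_eq_div, le_div_iff₀ ha]
      refine le_trans ?_ (pow_mul_amplified_zero_le hk.1.le hk.2.le hu n)
      exact mul_le_mul_of_nonneg_left hP0 (pow_nonneg hk.1.le n)
    have h7 := mul_le_mul_of_nonneg_right hC hPn
    linarith

/-! ### The birth and death equation -/

/-- The identity `(m - j) C(m, j) = (j + 1) C(m, j + 1)` removes `m` from the coefficients. The
formula therefore passes unchanged to mixtures over `m`, and its termwise bound needs no moment of
the mixing law. -/
theorem hasDerivAt_binomialMass {r : ℝ} (h0 : r ≠ 0) (m j : ℕ) :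
    HasDerivAt (fun r => binomialMass r m j)
      (1 / r * (j * binomialMass r m j - (j + 1) * binomialMass r m (j + 1))) r := by
  have h1 : HasDerivAt (fun r : ℝ => 1 - r) (-1) r := by
    simpa using (hasDerivAt_id r).const_sub 1
  have h := (((hasDerivAt_pow j r).const_mul (m.choose j : ℝ))).fun_mul (h1.fun_pow (m - j))
  refine h.congr_deriv ?_
  have hc : ((m.choose (j + 1) : ℕ) : ℝ) * ((j : ℝ) + 1) =
      (m.choose j : ℝ) * ((m - j : ℕ) : ℝ) := by
    exact_mod_cast Nat.choose_succ_right_eq m j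
  have hj : (j : ℝ) * r ^ (j - 1) = 1 / r * (j * r ^ j) := by
    cases j with
    | zero => simp
    | succ j =>
      rw [Nat.add_sub_cancel, pow_succ]
      field_simp
  rw [binomialMass, binomialMass, ← Nat.sub_sub m j 1, hj]
  have e : 1 / r * r ^ (j + 1) = r ^ j := by
    rw [pow_succ]
    field_simp
  linear_combination ((1 - r) ^ (m - j - 1) * r ^ j) * hc +
    ((j : ℝ) + 1) * (m.choose (j + 1) : ℝ) * (1 - r) ^ (m - j - 1) * e

theorem hasDerivAt_thinned {p : ℕ → ℝ} (hp : IsMassFunction p) {r : ℝ}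
    (hr : r ∈ Set.Ioo (0 : ℝ) 1) (j : ℕ) :
    HasDerivAt (fun r => thinned r p j)
      (1 / r * (j * thinned r p j - (j + 1) * thinned r p (j + 1))) r := by
  -- Restricting to `(r / 2, 1)` keeps the factor `1 / y` bounded, giving a summable majorant.
  have hr2 : 0 < r / 2 := half_pos hr.1
  have h := hasDerivAt_tsum_of_isPreconnected
    (g := fun m r => binomialMass r m j * p m)
    (g' := fun m r => 1 / r * (j * binomialMass r m j - (j + 1) * binomialMass r m (j + 1)) * p m)
    (u := fun m => 1 / (r / 2) * (j + (j + 1)) * p m) (t := Set.Ioo (r / 2) 1) (y₀ := r) (y := r)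
    (hp.hasSum.summable.mul_left _) isOpen_Ioo isPreconnected_Ioo
    (fun m y hy => (hasDerivAt_binomialMass (hr2.trans hy.1).ne' m j).mul_const _) ?_
    ⟨half_lt_self hr.1, hr.2⟩ (summable_binomialMass_mul hr.1.le hr.2.le hp j)
    ⟨half_lt_self hr.1, hr.2⟩
  · refine h.congr_deriv ?_
    have hs := ((((summable_binomialMass_mul hr.1.le hr.2.le hp j).hasSum.mul_left (j : ℝ)).sub
      ((summable_binomialMass_mul hr.1.le hr.2.le hp (j + 1)).hasSum.mul_left
        ((j : ℝ) + 1))).mul_left (1 / r)).tsum_eq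
    rw [thinned, thinned, ← hs]
    exact tsum_congr fun m => by ring
  · intro m y hy
    have hy0 : 0 < y := hr2.trans hy.1
    have b1 := binomialMass_nonneg hy0.le hy.2.le m j
    have b2 := binomialMass_nonneg hy0.le hy.2.le m (j + 1)
    have b3 := binomialMass_le_one hy0.le hy.2.le m j
    have b4 := binomialMass_le_one hy0.le hy.2.le m (j + 1)
    rw [Real.norm_eq_abs, abs_mul, abs_mul, abs_of_nonneg (hp.nonneg m),
      abs_of_pos (by positivity : 0 < 1 / y)]
    refine mul_le_mul_of_nonneg_right ?_ (hp.nonneg m)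
    refine mul_le_mul (one_div_le_one_div_of_le hr2 hy.1.le) ?_ (abs_nonneg _) (by positivity)
    have hj : (0 : ℝ) ≤ j := j.cast_nonneg
    have c1 : (j : ℝ) * binomialMass y m j ≤ j := mul_le_of_le_one_right hj b3
    have c2 : ((j : ℝ) + 1) * binomialMass y m (j + 1) ≤ j + 1 :=
      mul_le_of_le_one_right (by linarith) b4
    have c3 : 0 ≤ (j : ℝ) * binomialMass y m j := by positivity
    have c4 : 0 ≤ ((j : ℝ) + 1) * binomialMass y m (j + 1) := by positivity
    rw [abs_le]
    constructor <;> linarith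

theorem hasDerivAt_amplifierMass {k : ℝ} (h0 : k ≠ 0) (h1 : 1 - k ≠ 0) {j n : ℕ} (hj : j ≤ n) :
    HasDerivAt (fun k => amplifierMass k j n)
      (amplifierMass k j n * ((n - j) / k - (j + 1) / (1 - k))) k := by
  have hd : HasDerivAt (fun r : ℝ => 1 - r) (-1) k := by
    simpa using (hasDerivAt_id k).const_sub 1
  have h := (((hasDerivAt_pow (n - j) k).const_mul (n.choose j : ℝ))).fun_mul (hd.fun_pow (j + 1))
  refine h.congr_deriv ?_
  obtain ⟨d, rfl⟩ := Nat.exists_eq_add_of_le hj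
  rw [Nat.add_sub_cancel_left, amplifierMass, Nat.add_sub_cancel_left, Nat.add_sub_cancel]
  have e : (d : ℝ) * k ^ (d - 1) = d * k ^ d / k := by
    cases d with
    | zero => simp
    | succ d =>
      rw [Nat.add_sub_cancel, pow_succ]
      field_simp
  rw [e, pow_succ (1 - k)]
  push_cast
  field_simp
  ring

/-- Together with `succ_mul_amplified_succ`, this expresses the neighbouring masses in the birth and
death equation through sums over the kernel at level `n`. The truncated `n - 1` at `n = 0` is
harmless because of the factor `n`. -/
theorem nat_mul_amplified_pred {k : ℝ} (h0 : k ≠ 0) (u : ℕ → ℝ) (n : ℕ) :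
    (n : ℝ) * amplified k u (n - 1) = (n * amplified k u n -
      ∑ j ∈ Finset.range (n + 1), (j : ℝ) * (amplifierMass k j n * u j)) / k := by
  rw [eq_div_iff h0]
  cases n with
  | zero => simp
  | succ n =>
    rw [Nat.add_sub_cancel, amplified, amplified, Finset.mul_sum, Finset.mul_sum, Finset.sum_mul,
      ← Finset.sum_sub_distrib, Finset.sum_range_succ _ (n + 1)]
    rw [sub_self, add_zero]
    refine Finset.sum_congr rfl fun j hj => ?_
    obtain ⟨d, rfl⟩ := Nat.exists_eq_add_of_le (Finset.mem_range_succ_iff.1 hj)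
    have hc := Nat.choose_mul_succ_eq (j + d) j
    have hc' : ((j + d).choose j : ℝ) * ((j : ℝ) + d + 1) =
        ((j + d + 1).choose j : ℝ) * ((d : ℝ) + 1) := by
      rw [show j + d + 1 - j = d + 1 by omega] at hc
      exact_mod_cast hc
    rw [amplifierMass, amplifierMass, Nat.add_sub_cancel_left, show j + d + 1 - j = d + 1 by omega]
    push_cast
    linear_combination (k ^ (d + 1) * (1 - k) ^ (j + 1) * u j) * hc'

theorem succ_mul_amplifierMass_succ (k : ℝ) (j n : ℕ) :
    ((n : ℝ) + 1) * amplifierMass k (j + 1) (n + 1) =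
      k * (n + 1 + (j + 1)) * amplifierMass k (j + 1) n +
        (j + 1) * (1 - k) * amplifierMass k j n := by
  have hc : ((n : ℝ) + 1) * (n.choose j : ℝ) =
      ((n.choose j : ℝ) + (n.choose (j + 1) : ℝ)) * ((j : ℝ) + 1) := by
    have := Nat.add_one_mul_choose_eq n j
    rw [Nat.choose_succ_succ] at this
    exact_mod_cast this
  rw [amplifierMass_succ_succ, amplifierMass, amplifierMass]
  rcases lt_or_ge n (j + 1) with h | h
  · rw [Nat.choose_eq_zero_of_lt h] at hc ⊢
    push_cast at hc ⊢
    linear_combination (k ^ (n - j) * (1 - k) ^ (j + 2)) * hc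
  · obtain ⟨d, rfl⟩ := Nat.exists_eq_add_of_le h
    rw [Nat.add_sub_cancel_left, show j + 1 + d - j = d + 1 by omega]
    linear_combination (k ^ (d + 1) * (1 - k) ^ (j + 2)) * hc

theorem succ_mul_amplified_succ (k : ℝ) (u : ℕ → ℝ) (n : ℕ) :
    ((n : ℝ) + 1) * amplified k u (n + 1) =
      k * ((n + 1) * amplified k u n +
        ∑ j ∈ Finset.range (n + 1), (j : ℝ) * (amplifierMass k j n * u j)) +
      (1 - k) * ∑ j ∈ Finset.range (n + 1), ((j : ℝ) + 1) * (amplifierMass k j n * u (j + 1)) := by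
  have e1 : k * ((n + 1) * amplified k u n +
      ∑ j ∈ Finset.range (n + 1), (j : ℝ) * (amplifierMass k j n * u j)) =
      ∑ j ∈ Finset.range (n + 1), k * (n + 1 + ((j + 1 : ℕ) : ℝ)) *
        (amplifierMass k (j + 1) n * u (j + 1)) + k * (n + 1) * (amplifierMass k 0 n * u 0) := by
    have := Finset.sum_range_succ' (fun j : ℕ => k * (n + 1 + (j : ℝ)) *
      (amplifierMass k j n * u j)) (n + 1)
    rw [Finset.sum_range_succ, amplifierMass_of_lt (Nat.lt_succ_self n), zero_mul, mul_zero,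
      add_zero, Nat.cast_zero, add_zero] at this
    rw [← this, amplified, Finset.mul_sum, ← Finset.sum_add_distrib, Finset.mul_sum]
    exact Finset.sum_congr rfl fun j _ => by ring
  rw [e1, amplified, Finset.sum_range_succ', amplifierMass_zero_succ, mul_add, Finset.mul_sum,
    Finset.mul_sum, add_right_comm, ← Finset.sum_add_distrib]
  congr 1
  · refine Finset.sum_congr rfl fun j _ => ?_
    have := succ_mul_amplifierMass_succ k j n
    push_cast
    linear_combination u (j + 1) * this
  · ring

/-- The probability current of the birth and death process that drives `attenuated`. -/
def attenuatedCurrent (p : ℕ → ℝ) (l t : ℝ) (n : ℕ) : ℝ :=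
  l * ((n + 1) * attenuated p l t n) - (1 + l) * ((n + 1) * attenuated p l t (n + 1))

/-- The birth and death equation satisfied by `attenuated`. -/
theorem hasDerivAt_attenuated {p : ℕ → ℝ} (hp : IsMassFunction p) {l t : ℝ} (hl : 0 < l)
    (ht : t ∈ Set.Ioo (0 : ℝ) 1) (n : ℕ) :
    HasDerivAt (fun t => attenuated p l t n)
      (1 / t * (l * ((n + 1) * attenuated p l t n - n * attenuated p l t (n - 1)) +
        (1 + l) * (n * attenuated p l t n - (n + 1) * attenuated p l t (n + 1)))) t := by
  obtain ⟨hb, hk, hr⟩ := attenuated_params hl ht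
  have ht0 := ht.1.ne'
  have ht1 : 1 - t ≠ 0 := by linarith [ht.2]
  have hb1 : 1 + (1 - t) * l ≠ 0 := by linarith
  have db : HasDerivAt (fun t : ℝ => (1 - t) * l) (-l) t := by
    simpa using ((hasDerivAt_id t).const_sub 1).mul_const l
  have db1 : HasDerivAt (fun t : ℝ => 1 + (1 - t) * l) (-l) t := db.const_add 1
  have dk : HasDerivAt (fun t : ℝ => (1 - t) * l / (1 + (1 - t) * l))
      (-l / (1 + (1 - t) * l) ^ 2) t :=
    (db.div db1 hb1).congr_deriv (by ring)
  have dr : HasDerivAt (fun t : ℝ => t / (1 + (1 - t) * l))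
      ((1 + l) / (1 + (1 - t) * l) ^ 2) t :=
    ((hasDerivAt_id t).div db1 hb1).congr_deriv (by simp only [id]; ring)
  have h1k : 1 - (1 - t) * l / (1 + (1 - t) * l) ≠ 0 := by linarith [hk.2]
  have hd : ∀ j ∈ Finset.range (n + 1), HasDerivAt
      (fun t => amplifierMass ((1 - t) * l / (1 + (1 - t) * l)) j n *
        thinned (t / (1 + (1 - t) * l)) p j) _ t := fun j hj =>
    HasDerivAt.fun_mul
      (HasDerivAt.comp (h₂ := fun k => amplifierMass k j n) t
        (hasDerivAt_amplifierMass hk.1.ne' h1k (Finset.mem_range_succ_iff.1 hj)) dk)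
      (HasDerivAt.comp (h₂ := fun r => thinned r p j) t (hasDerivAt_thinned hp hr j) dr)
  have h := HasDerivAt.fun_sum hd
  refine h.congr_deriv ?_
  simp only [attenuated]
  -- Both sides now involve only the amplified mass, `S1` and `T`, so the claim is a rational
  -- identity in their coefficients.
  rw [nat_mul_amplified_pred hk.1.ne', succ_mul_amplified_succ]
  set k := (1 - t) * l / (1 + (1 - t) * l) with hkdef
  set r := t / (1 + (1 - t) * l) with hrdef
  set u := thinned r p with hu
  set S1 := ∑ j ∈ Finset.range (n + 1), (j : ℝ) * (amplifierMass k j n * u j) with hS1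
  set T := ∑ j ∈ Finset.range (n + 1), ((j : ℝ) + 1) * (amplifierMass k j n * u (j + 1)) with hT
  have hsum : ∑ j ∈ Finset.range (n + 1), (amplifierMass k j n * ((n - j) / k - (j + 1) / (1 - k)) *
      (-l / (1 + (1 - t) * l) ^ 2) * u j + amplifierMass k j n *
        (1 / r * (j * u j - (j + 1) * u (j + 1)) * ((1 + l) / (1 + (1 - t) * l) ^ 2))) =
      (-l / (1 + (1 - t) * l) ^ 2) * ((n / k - 1 / (1 - k)) * amplified k u n -
        (1 / k + 1 / (1 - k)) * S1) + (1 / r * ((1 + l) / (1 + (1 - t) * l) ^ 2)) * (S1 - T) := by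
    rw [hS1, hT, amplified]
    simp only [Finset.mul_sum, ← Finset.sum_sub_distrib, ← Finset.sum_add_distrib]
    exact Finset.sum_congr rfl fun j _ => by ring
  rw [hsum]
  have e1 : 1 - k = 1 / (1 + (1 - t) * l) := by rw [hkdef]; field_simp; ring
  rw [e1, hkdef, hrdef]
  generalize amplified _ u n = S0
  clear_value S1 T
  obtain ⟨B, hB⟩ : ∃ B, B = 1 + (1 - t) * l := ⟨_, rfl⟩
  have hbB : (1 - t) * l = B - 1 := by rw [hB]; ring
  have hB0 : B ≠ 0 := by rw [hB]; exact hb1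
  have hB1 : B - 1 ≠ 0 := by rw [← hbB]; exact hb.ne'
  have hlB : l = (B - 1) / (1 - t) := by rw [← hbB]; field_simp
  rw [← hB, hbB, hlB]
  field_simp
  ring

theorem hasDerivAt_attenuated_zero {p : ℕ → ℝ} (hp : IsMassFunction p) {l t : ℝ} (hl : 0 < l)
    (ht : t ∈ Set.Ioo (0 : ℝ) 1) :
    HasDerivAt (fun t => attenuated p l t 0) (1 / t * attenuatedCurrent p l t 0) t := by
  refine (hasDerivAt_attenuated hp hl ht 0).congr_deriv ?_
  simp only [attenuatedCurrent, Nat.cast_zero]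
  ring

theorem hasDerivAt_attenuated_succ {p : ℕ → ℝ} (hp : IsMassFunction p) {l t : ℝ} (hl : 0 < l)
    (ht : t ∈ Set.Ioo (0 : ℝ) 1) (n : ℕ) :
    HasDerivAt (fun t => attenuated p l t (n + 1))
      (1 / t * (attenuatedCurrent p l t (n + 1) - attenuatedCurrent p l t n)) t := by
  refine (hasDerivAt_attenuated hp hl ht (n + 1)).congr_deriv ?_
  simp only [attenuatedCurrent, Nat.add_sub_cancel]
  push_cast
  ring

/-! ### Differentiating the entropy by Cesàro summation -/

theorem sum_sub_prev_mul (J v : ℕ → ℝ) (N : ℕ) :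
    ∑ n ∈ Finset.range N, (J n - if n = 0 then 0 else J (n - 1)) * v n =
      ∑ n ∈ Finset.range N, J n * (v n - v (n + 1)) + (if N = 0 then 0 else J (N - 1)) * v N := by
  induction N with
  | zero => simp
  | succ N ih =>
    rw [Finset.sum_range_succ, Finset.sum_range_succ, ih]
    simp only [Nat.add_one_ne_zero, if_false, Nat.add_sub_cancel]
    ring

/-- A positive mass function whose successive ratios lie between `c` and `C`. -/
structure HasRatioBounds (a c C : ℝ) (P : ℕ → ℝ) : Prop where
  le_zero : a ≤ P 0
  mul_le : ∀ n, c * P n ≤ P (n + 1)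
  le_mul : ∀ n, P (n + 1) ≤ C * P n

namespace HasRatioBounds

variable {a c C : ℝ} {P : ℕ → ℝ}

theorem pow_mul_le (h : HasRatioBounds a c C P) (hc : 0 < c) (n : ℕ) : c ^ n * a ≤ P n := by
  induction n with
  | zero => simpa using h.le_zero
  | succ n ih =>
    refine le_trans ?_ (h.mul_le n)
    rw [pow_succ', mul_assoc]
    exact mul_le_mul_of_nonneg_left ih hc.le

theorem pos (h : HasRatioBounds a c C P) (ha : 0 < a) (hc : 0 < c) (n : ℕ) : 0 < P n :=
  lt_of_lt_of_le (by positivity) (h.pow_mul_le hc n)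

/-- The lower ratio bound gives `c ^ n * a ≤ P n ≤ 1`; linear growth of the logarithm is what a
finite first moment can pay for. -/
theorem abs_log_le (h : HasRatioBounds a c C P) (ha : 0 < a) (hc : 0 < c) (hP : IsMassFunction P)
    (n : ℕ) : |Real.log (P n)| ≤ (|Real.log c| + |Real.log a|) * (n + 1) := by
  have hpos := h.pos ha hc n
  have h1 : P n ≤ 1 := le_hasSum hP.hasSum n fun i _ => hP.nonneg i
  have h2 := Real.log_le_log (by positivity) (h.pow_mul_le hc n)
  rw [Real.log_mul (by positivity) ha.ne', Real.log_pow] at h2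
  rw [abs_of_nonpos (Real.log_nonpos hpos.le h1)]
  have h3 := neg_abs_le (Real.log c)
  have h4 := neg_abs_le (Real.log a)
  have h5 : 0 ≤ |Real.log c| := abs_nonneg _
  have h6 : 0 ≤ |Real.log a| := abs_nonneg _
  have h7 : (0 : ℝ) ≤ n := n.cast_nonneg
  nlinarith [mul_le_mul_of_nonneg_left h3 h7, mul_nonneg h7 h6]

theorem abs_log_sub_le (h : HasRatioBounds a c C P) (ha : 0 < a) (hc : 0 < c) (n : ℕ) :
    |Real.log (P n) - Real.log (P (n + 1))| ≤ |Real.log c| + |Real.log C| := by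
  have hpos := h.pos ha hc n
  have hpos1 := h.pos ha hc (n + 1)
  have hC : 0 < C := by
    by_contra! hC
    have := h.le_mul n
    nlinarith
  have h1 := Real.log_le_log (by positivity) (h.mul_le n)
  have h2 := Real.log_le_log hpos1 (h.le_mul n)
  rw [Real.log_mul hc.ne' hpos.ne'] at h1
  rw [Real.log_mul hC.ne' hpos.ne'] at h2
  have h3 := neg_abs_le (Real.log c)
  have h4 := le_abs_self (Real.log C)
  have h5 : 0 ≤ |Real.log c| := abs_nonneg _
  have h6 : 0 ≤ |Real.log C| := abs_nonneg _
  rw [abs_le]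
  constructor <;> linarith

theorem summable_mul_log (h : HasRatioBounds a c C P) (ha : 0 < a) (hc : 0 < c)
    (hP : IsMassFunction P) (hm : Summable fun n : ℕ => ((n : ℝ) + 1) * P n) :
    Summable fun n => P n * Real.log (P n) := by
  refine (hm.mul_left (|Real.log c| + |Real.log a|)).of_norm_bounded fun n => ?_
  rw [norm_mul, Real.norm_of_nonneg (hP.nonneg n), Real.norm_eq_abs]
  have := mul_le_mul_of_nonneg_left (h.abs_log_le ha hc hP n) (hP.nonneg n)
  linarith

theorem summable_mul_log_sub (h : HasRatioBounds a c C P) (ha : 0 < a) (hc : 0 < c)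
    (hm : Summable fun n : ℕ => ((n : ℝ) + 1) * P n) {J : ℕ → ℝ} {B : ℝ}
    (hJ : ∀ n : ℕ, |J n| ≤ B * ((n + 1) * P n)) :
    Summable fun n => J n * (Real.log (P n) - Real.log (P (n + 1))) := by
  refine ((hm.mul_left B).mul_right (|Real.log c| + |Real.log C|)).of_norm_bounded fun n => ?_
  rw [norm_mul, Real.norm_eq_abs, Real.norm_eq_abs]
  exact mul_le_mul (hJ n) (h.abs_log_sub_le ha hc n) (abs_nonneg _) ((abs_nonneg _).trans (hJ n))

end HasRatioBounds

/-- The Cesàro deficiency weight. -/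
def cesaroDefect (N n : ℕ) : ℝ := min 1 (((n : ℝ) + 1) / (N + 1))

theorem cesaroDefect_mem (N n : ℕ) : 0 ≤ cesaroDefect N n ∧ cesaroDefect N n ≤ 1 :=
  ⟨le_min zero_le_one (by positivity), min_le_left _ _⟩

theorem cesaroDefect_of_lt {N n : ℕ} (h : n < N + 1) :
    cesaroDefect N n = ((n : ℝ) + 1) / (N + 1) := by
  refine min_eq_right ?_
  rw [div_le_one (by positivity)]
  exact_mod_cast h

theorem cesaroDefect_of_le {N n : ℕ} (h : N ≤ n) : cesaroDefect N n = 1 := by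
  refine min_eq_left ?_
  rw [le_div_iff₀ (by positivity), one_mul]
  exact_mod_cast Nat.succ_le_succ h

theorem antitone_cesaroDefect (n : ℕ) : Antitone fun N => cesaroDefect N n := by
  intro N M h
  refine min_le_min le_rfl ?_
  have : (N : ℝ) ≤ M := by exact_mod_cast h
  gcongr

theorem tendsto_cesaroDefect (n : ℕ) :
    Filter.Tendsto (fun N => cesaroDefect N n) Filter.atTop (nhds 0) := by
  refine squeeze_zero (fun N => (cesaroDefect_mem N n).1) (fun N => min_le_right _ _) ?_
  have := (tendsto_one_div_add_atTop_nhds_zero_nat (𝕜 := ℝ)).const_mul ((n : ℝ) + 1)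
  simpa [div_eq_mul_inv] using this

/-- Cesàro sums of a dominated series converge locally uniformly. -/
theorem tendstoLocallyUniformlyOn_cesaro {U : Set ℝ} {f : ℝ → ℕ → ℝ} {M : ℝ → ℝ}
    (hf0 : ∀ t ∈ U, ∀ n, 0 ≤ f t n) (hfc : ∀ n, ContinuousOn (fun t => f t n) U)
    (hM : ContinuousOn M U) (hsum : ∀ t ∈ U, HasSum (f t) (M t)) :
    TendstoLocallyUniformlyOn (fun N t => ∑' n, (1 - cesaroDefect N n) * f t n) M Filter.atTop
      U := by
  have hle : ∀ N, ∀ t ∈ U, ∀ n, (1 - cesaroDefect N n) * f t n ≤ f t n := fun N t ht n =>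
    mul_le_of_le_one_left (hf0 t ht n) (by linarith [(cesaroDefect_mem N n).1])
  have h0 : ∀ N, ∀ t ∈ U, ∀ n, 0 ≤ (1 - cesaroDefect N n) * f t n := fun N t ht n =>
    mul_nonneg (by linarith [(cesaroDefect_mem N n).2]) (hf0 t ht n)
  have hs : ∀ N, ∀ t ∈ U, Summable fun n => (1 - cesaroDefect N n) * f t n := fun N t ht =>
    Summable.of_nonneg_of_le (h0 N t ht) (hle N t ht) (hsum t ht).summable
  -- Dini's theorem: continuous finite sums increase pointwise to a continuous limit.
  refine Monotone.tendstoLocallyUniformlyOn_of_forall_tendsto (fun N => ?_)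
    (fun t ht N N' hN => (hs N t ht).tsum_le_tsum (fun n => ?_) (hs N' t ht)) hM
    (fun t ht => ?_)
  · have e : (fun t => ∑' n, (1 - cesaroDefect N n) * f t n) =
        fun t => ∑ n ∈ Finset.range N, (1 - cesaroDefect N n) * f t n := by
      ext t
      refine tsum_eq_sum fun n hn => ?_
      rw [cesaroDefect_of_le (by simpa using hn), sub_self, zero_mul]
    rw [e]
    exact continuousOn_finsetSum _ fun n _ => continuousOn_const.mul (hfc n)
  · have := antitone_cesaroDefect n hN
    simp only at this
    exact mul_le_mul_of_nonneg_right (by linarith) (hf0 t ht n)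
  · have h := tendsto_tsum_of_dominated_convergence (𝓕 := Filter.atTop)
      (f := fun N n => (1 - cesaroDefect N n) * f t n) (g := fun n => f t n) (bound := f t)
      (hsum t ht).summable (fun n => ?_) (Filter.Eventually.of_forall fun N n => ?_)
    · rwa [(hsum t ht).tsum_eq] at h
    · simpa using ((tendsto_cesaroDefect n).const_sub 1).mul_const (f t n)
    · rw [Real.norm_of_nonneg (h0 N t ht n)]
      exact hle N t ht n

theorem tendsto_cesaro_sum {g : ℕ → ℝ} (hg : Summable g) :
    Filter.Tendsto (fun N : ℕ => ∑ n ∈ Finset.range (N + 1), (1 - (n : ℝ) / (N + 1)) * g n)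
      Filter.atTop (nhds (∑' n, g n)) := by
  have h := tendsto_tsum_of_dominated_convergence (𝓕 := Filter.atTop)
    (f := fun (N n : ℕ) => (if n < N + 1 then 1 - (n : ℝ) / (N + 1) else 0) * g n) (g := g)
    (bound := fun n => |g n|) hg.abs (fun n => ?_) (Filter.Eventually.of_forall fun N n => ?_)
  · refine h.congr fun N => ?_
    rw [tsum_eq_sum (s := Finset.range (N + 1)) fun n hn => by
      rw [if_neg (by simpa using hn), zero_mul]]
    exact Finset.sum_congr rfl fun n hn => by rw [if_pos (Finset.mem_range.1 hn)]
  · have h1 : Filter.Tendsto (fun N : ℕ => 1 - (n : ℝ) / (N + 1)) Filter.atTop (nhds (1 - 0)) := by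
      have := (tendsto_one_div_add_atTop_nhds_zero_nat (𝕜 := ℝ)).const_mul (n : ℝ)
      simp only [mul_one_div, mul_zero] at this
      exact this.const_sub 1
    have h2 : Filter.Tendsto (fun N : ℕ => if n < N + 1 then 1 - (n : ℝ) / (N + 1) else 0)
        Filter.atTop (nhds 1) := by
      rw [sub_zero] at h1
      refine h1.congr' ?_
      filter_upwards [Filter.eventually_ge_atTop n] with N hN
      rw [if_pos (by omega)]
    simpa using h2.mul_const (g n)
  · rw [Real.norm_eq_abs, abs_mul]
    refine mul_le_of_le_one_left (abs_nonneg _) ?_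
    split_ifs with hn
    · have h3 : (n : ℝ) / (N + 1) ≤ 1 := by
        rw [div_le_one (by positivity)]
        exact_mod_cast hn.le
      have h4 : 0 ≤ (n : ℝ) / (N + 1) := by positivity
      rw [abs_le]
      constructor <;> linarith
    · simp

/-- The Cesàro weight vanishes at `N + 1`, so summation by parts has no boundary term. For `n ≤ N`
the discrepancy is `J n` times a quantity of order `(n + 1) / (N + 1)`; beyond `N` it is a tail with
bounded logarithmic increments. Both fit under `cesaroDefect` times the first-moment term. -/
theorem abs_cesaro_sub_tsum_le {a c C B M : ℝ} {P J : ℕ → ℝ} (h : HasRatioBounds a c C P)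
    (ha : 0 < a) (hc : 0 < c) (hP : IsMassFunction P)
    (hm : HasSum (fun n : ℕ => ((n : ℝ) + 1) * P n) M) (hB : 0 ≤ B)
    (hJ : ∀ n : ℕ, |J n| ≤ B * ((n + 1) * P n)) (N : ℕ) :
    |(∑ n ∈ Finset.range (N + 1), (1 - (n : ℝ) / (N + 1)) *
        ((J n - if n = 0 then 0 else J (n - 1)) * (Real.log (P n) + 1))) -
      ∑' n, J n * (Real.log (P n) - Real.log (P (n + 1)))| ≤
      B * (|Real.log c| + |Real.log C| + 2 * (|Real.log c| + |Real.log a|) + 1) *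
        (M - ∑' n : ℕ, (1 - cesaroDefect N n) * ((n + 1) * P n)) := by
  set K := |Real.log c| + |Real.log a| with hK
  set R := |Real.log c| + |Real.log C| with hR
  have hK0 : 0 ≤ K := by positivity
  have hR0 : 0 ≤ R := by positivity
  set ℓ : ℕ → ℝ := fun n => Real.log (P n) + 1 with hℓ
  have hN : (0 : ℝ) < N + 1 := by positivity
  have hsum : ∑ n ∈ Finset.range (N + 1), (1 - (n : ℝ) / (N + 1)) *
      ((J n - if n = 0 then 0 else J (n - 1)) * (Real.log (P n) + 1)) =
      ∑' n, if n < N + 1 then J n * ((1 - (n : ℝ) / (N + 1)) * ℓ n -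
        (1 - ((n + 1 : ℕ) : ℝ) / (N + 1)) * ℓ (n + 1)) else 0 := by
    have h1 := sum_sub_prev_mul J (fun n => (1 - (n : ℝ) / (N + 1)) * ℓ n) (N + 1)
    have h2 : 1 - ((N + 1 : ℕ) : ℝ) / (N + 1) = 0 := by
      push_cast
      rw [div_self hN.ne', sub_self]
    simp only [h2, zero_mul, mul_zero, add_zero] at h1
    rw [tsum_eq_sum (s := Finset.range (N + 1)) fun n hn => if_neg (by simpa using hn)]
    rw [Finset.sum_congr rfl fun n hn => if_pos (Finset.mem_range.1 hn), ← h1]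
    exact Finset.sum_congr rfl fun n _ => by ring
  have hsJ := h.summable_mul_log_sub ha hc hm.summable hJ
  have hfin : Summable fun n => if n < N + 1 then J n * ((1 - (n : ℝ) / (N + 1)) * ℓ n -
        (1 - ((n + 1 : ℕ) : ℝ) / (N + 1)) * ℓ (n + 1)) else 0 :=
    summable_of_ne_finset_zero (s := Finset.range (N + 1)) fun n hn => if_neg (by simpa using hn)
  have hdef : HasSum (fun n : ℕ => cesaroDefect N n * ((n + 1) * P n))
      (M - ∑' n : ℕ, (1 - cesaroDefect N n) * ((n + 1) * P n)) := by
    have hs : Summable fun n : ℕ => (1 - cesaroDefect N n) * (((n : ℝ) + 1) * P n) := by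
      have h0 : ∀ n : ℕ, 0 ≤ ((n : ℝ) + 1) * P n := fun n =>
        mul_nonneg (by positivity) (hP.nonneg n)
      refine Summable.of_nonneg_of_le (fun n => mul_nonneg ?_ (h0 n))
        (fun n => mul_le_of_le_one_left (h0 n) ?_) hm.summable
      · linarith [(cesaroDefect_mem N n).2]
      · linarith [(cesaroDefect_mem N n).1]
    have := hm.sub hs.hasSum
    have e : (fun n : ℕ => cesaroDefect N n * (((n : ℝ) + 1) * P n)) = fun n : ℕ =>
      ((n : ℝ) + 1) * P n - (1 - cesaroDefect N n) * (((n : ℝ) + 1) * P n) := by ext n; ring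
    rw [e]
    exact this
  rw [hsum, ← hfin.tsum_sub hsJ, ← Real.norm_eq_abs]
  refine tsum_of_norm_bounded (hdef.mul_left (B * (R + 2 * K + 1))) fun n => ?_
  have hD := h.abs_log_sub_le ha hc n
  have hL := h.abs_log_le ha hc hP (n + 1)
  rw [← hK] at hL
  rw [← hR] at hD
  have hnP : 0 ≤ ((n : ℝ) + 1) * P n := mul_nonneg (by positivity) (hP.nonneg n)
  rw [Real.norm_eq_abs]
  split_ifs with hn
  · rw [cesaroDefect_of_lt hn]
    have e : J n * ((1 - (n : ℝ) / (N + 1)) * ℓ n -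
        (1 - ((n + 1 : ℕ) : ℝ) / (N + 1)) * ℓ (n + 1)) -
          J n * (Real.log (P n) - Real.log (P (n + 1))) =
        J n * ((Real.log (P (n + 1)) + 1 - n * (Real.log (P n) - Real.log (P (n + 1)))) /
          (N + 1)) := by
      simp only [hℓ]
      push_cast
      field_simp
      ring
    rw [e, abs_mul, abs_div, abs_of_pos hN]
    have h3 : |Real.log (P (n + 1)) + 1 - n * (Real.log (P n) - Real.log (P (n + 1)))| ≤
        (R + 2 * K + 1) * (n + 1) := by
      have hn0 : (0 : ℝ) ≤ n := n.cast_nonneg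
      have t1 : |(n : ℝ) * (Real.log (P n) - Real.log (P (n + 1)))| ≤ n * R := by
        rw [abs_mul, abs_of_nonneg hn0]
        exact mul_le_mul_of_nonneg_left hD hn0
      have t2 := abs_sub (Real.log (P (n + 1)) + 1) (n * (Real.log (P n) - Real.log (P (n + 1))))
      have t3 := abs_add_le (Real.log (P (n + 1))) 1
      rw [abs_one] at t3
      push_cast at hL
      nlinarith [mul_nonneg hn0 hK0]
    calc |J n| * (|Real.log (P (n + 1)) + 1 - n * (Real.log (P n) - Real.log (P (n + 1)))| /
          (N + 1)) ≤ B * ((n + 1) * P n) * ((R + 2 * K + 1) * (n + 1) / (N + 1)) := by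
          have := hJ n
          gcongr
      _ = _ := by ring
  · rw [cesaroDefect_of_le (by omega), zero_sub, abs_neg, abs_mul]
    calc |J n| * |Real.log (P n) - Real.log (P (n + 1))| ≤ B * ((n + 1) * P n) * R := by
          have := hJ n
          gcongr
      _ ≤ B * ((n + 1) * P n) * (R + 2 * K + 1) := by
          gcongr
          linarith
      _ = _ := by ring

/-- Derivative of the negative entropy along a birth and death flow with current `J`. -/
theorem hasDerivAt_tsum_mul_log {U : Set ℝ} (hU : IsOpen U) {P J : ℝ → ℕ → ℝ} {M : ℝ → ℝ}
    {a c C B : ℝ} (ha : 0 < a) (hc : 0 < c) (hB : 0 ≤ B) (hP : ∀ t ∈ U, IsMassFunction (P t))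
    (hM : ContinuousOn M U) (hm : ∀ t ∈ U, HasSum (fun n : ℕ => ((n : ℝ) + 1) * P t n) (M t))
    (hr : ∀ t ∈ U, HasRatioBounds a c C (P t))
    (hd : ∀ t ∈ U, ∀ n, HasDerivAt (fun t => P t n)
      (J t n - if n = 0 then 0 else J t (n - 1)) t)
    (hJ : ∀ t ∈ U, ∀ n : ℕ, |J t n| ≤ B * ((n + 1) * P t n)) {t : ℝ} (ht : t ∈ U) :
    HasDerivAt (fun t => ∑' n, P t n * Real.log (P t n))
      (∑' n, J t n * (Real.log (P t n) - Real.log (P t (n + 1)))) t := by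
  set B' := B * (|Real.log c| + |Real.log C| + 2 * (|Real.log c| + |Real.log a|) + 1) with hB'
  have hB'0 : 0 ≤ B' := by positivity
  have hV := tendstoLocallyUniformlyOn_cesaro (U := U) (f := fun t n => ((n : ℝ) + 1) * P t n)
    (fun t ht n => mul_nonneg (by positivity) ((hP t ht).nonneg n))
    (fun n t ht => ((hd t ht n).continuousAt.continuousWithinAt).const_mul _) hM hm
  refine hasDerivAt_of_tendstoLocallyUniformlyOn (l := Filter.atTop) hU
    (f := fun (N : ℕ) t => ∑ n ∈ Finset.range (N + 1),
      (1 - (n : ℝ) / (N + 1)) * (P t n * Real.log (P t n)))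
    (f' := fun (N : ℕ) t => ∑ n ∈ Finset.range (N + 1), (1 - (n : ℝ) / (N + 1)) *
        ((J t n - if n = 0 then 0 else J t (n - 1)) * (Real.log (P t n) + 1)))
    (g' := fun t => ∑' n, J t n * (Real.log (P t n) - Real.log (P t (n + 1))))
    ?_ (Filter.Eventually.of_forall fun N t ht => ?_) (fun t ht => ?_) ht
  · rw [Metric.tendstoLocallyUniformlyOn_iff] at hV ⊢
    intro ε hε t ht
    -- The error is at most `B'` times the moment deficiency; dividing by `B' + 1` also covers `B' =
    -- 0`.
    obtain ⟨s, hs, hs2⟩ := hV (ε / (B' + 1)) (by positivity) t ht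
    refine ⟨s ∩ U, Filter.inter_mem hs self_mem_nhdsWithin, ?_⟩
    filter_upwards [hs2] with N hN y hy
    have h1 := abs_cesaro_sub_tsum_le (hr y hy.2) ha hc (hP y hy.2) (hm y hy.2) hB (hJ y hy.2) N
    have h2 := hN y hy.1
    rw [Real.dist_eq] at h2
    rw [Real.dist_eq, abs_sub_comm]
    refine h1.trans_lt ?_
    rw [← hB']
    rw [lt_div_iff₀ (by positivity)] at h2
    have h3 := mul_le_mul_of_nonneg_left (le_abs_self
      (M y - ∑' n : ℕ, (1 - cesaroDefect N n) * ((n + 1) * P y n))) hB'0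
    have h4 := abs_nonneg (M y - ∑' n : ℕ, (1 - cesaroDefect N n) * ((n + 1) * P y n))
    linarith
  · refine HasDerivAt.fun_sum fun n _ => HasDerivAt.const_mul _ ?_
    have hpos := (hr t ht).pos ha hc n
    have := (Real.hasDerivAt_mul_log hpos.ne').comp t (hd t ht n)
    exact this.congr_deriv (mul_comm _ _)
  · exact tendsto_cesaro_sum ((hr t ht).summable_mul_log ha hc (hP t ht) (hm t ht).summable)

/-! ### The three relative entropies as series -/

theorem hasSum_nat_mul_of_succ {P : ℕ → ℝ} {L : ℝ} (hP : IsMassFunction P)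
    (hm : HasSum (fun n : ℕ => ((n : ℝ) + 1) * P n) (1 + L)) :
    HasSum (fun n : ℕ => (n : ℝ) * P n) L := by
  have h := hm.sub hP.hasSum
  rw [add_sub_cancel_left] at h
  have e : (fun n : ℕ => (n : ℝ) * P n) = fun n : ℕ => ((n : ℝ) + 1) * P n - P n := by
    ext n; ring
  rw [e]
  exact h

theorem hasSum_succ_mul_succ {P : ℕ → ℝ} {L : ℝ} (hm : HasSum (fun n : ℕ => (n : ℝ) * P n) L) :
    HasSum (fun n : ℕ => ((n : ℝ) + 1) * P (n + 1)) L := by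
  rw [← hasSum_nat_add_iff' 1] at hm
  simpa using hm

theorem isMassFunction_massPlus {P : ℕ → ℝ} {L : ℝ} (hL : 0 < L) (hP : IsMassFunction P)
    (hm : HasSum (fun n : ℕ => (n : ℝ) * P n) L) : IsMassFunction (massPlus P) := by
  have hmean : massMean P = L := hm.tsum_eq
  refine ⟨fun n => ?_, ?_⟩
  · rw [massPlus, hmean]
    have := hP.nonneg (n + 1)
    positivity
  · have := (hasSum_succ_mul_succ hm).div_const L
    rw [div_self hL.ne', ← hmean] at this
    exact this

theorem isMassFunction_massMinus {P : ℕ → ℝ} {L : ℝ} (hL : 0 < L) (hP : IsMassFunction P)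
    (hm : HasSum (fun n : ℕ => (n : ℝ) * P n) L) : IsMassFunction (massMinus P) := by
  have hmean : massMean P = L := hm.tsum_eq
  refine ⟨fun n => ?_, ?_⟩
  · rw [massMinus, hmean]
    have := hP.nonneg n
    positivity
  · have := (hm.add hP.hasSum).div_const (1 + L)
    rw [add_comm L 1, div_self (by positivity), ← hmean] at this
    have e : massMinus P = fun n : ℕ => ((n : ℝ) * P n + P n) / (1 + massMean P) := by
      ext n; rw [massMinus]; ring
    rw [e]
    exact this

/-- Relative entropy to the geometric mass function of the same mean. -/
theorem relEntropy_geometricMass {P : ℕ → ℝ} {L : ℝ} (hL : 0 < L) (hP : IsMassFunction P)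
    (hpos : ∀ n, 0 < P n) (hm : HasSum (fun n : ℕ => (n : ℝ) * P n) L)
    (hs : Summable fun n => P n * Real.log (P n)) :
    relEntropy P (geometricMass L) ≠ ∞ ∧ (relEntropy P (geometricMass L)).toReal =
      ∑' n, P n * Real.log (P n) + ((1 + L) * Real.log (1 + L) - L * Real.log L) := by
  have hq : ∀ n, 0 < geometricMass L n := fun n => by unfold geometricMass; positivity
  have hsum : HasSum (fun n => P n * Real.log (P n / geometricMass L n))
      (∑' n, P n * Real.log (P n) + ((1 + L) * Real.log (1 + L) - L * Real.log L)) := by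
    have h := hs.hasSum.add ((hm.add hP.hasSum).mul_right (Real.log (1 + L)) |>.sub
      (hm.mul_right (Real.log L)))
    rw [add_comm L 1] at h
    have e : (fun n => P n * Real.log (P n / geometricMass L n)) = fun n : ℕ =>
        P n * Real.log (P n) + ((n * P n + P n) * Real.log (1 + L) - n * P n * Real.log L) := by
      ext n
      rw [Real.log_div (hpos n).ne' (hq n).ne', geometricMass,
        Real.log_div (by positivity) (by positivity), Real.log_pow, Real.log_pow]
      push_cast
      ring
    rw [e]
    exact h
  have h := relEntropy_eq_tsum hP (isMassFunction_geometricMass hL) hq hsum.summable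
  rw [hsum.tsum_eq] at h
  exact h

/-- The size-bias factor `n + 1` cancels in the quotient, leaving an increment of `log P` and
normalising constants. -/
theorem log_massMinus_div_massPlus {P : ℕ → ℝ} (hL : 0 < massMean P) (hpos : ∀ n, 0 < P n)
    (n : ℕ) : Real.log (massMinus P n / massPlus P n) =
      Real.log (P n) - Real.log (P (n + 1)) + Real.log (massMean P) -
        Real.log (1 + massMean P) := by
  have h0 := hpos n
  have h1 := hpos (n + 1)
  have hn : (0 : ℝ) < n + 1 := by positivity
  rw [massMinus, massPlus, Real.log_div (by positivity) (by positivity),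
    Real.log_div (by positivity) (by positivity), Real.log_div (by positivity) (by positivity),
    Real.log_mul hn.ne' h0.ne', Real.log_mul hn.ne' h1.ne']
  ring

/-- The relative entropy `D(p⁻ ‖ p⁺)` as a series of logarithmic increments. -/
theorem relEntropy_massMinus_massPlus {P : ℕ → ℝ} {L : ℝ} (hL : 0 < L) (hP : IsMassFunction P)
    (hpos : ∀ n, 0 < P n) (hm : HasSum (fun n : ℕ => (n : ℝ) * P n) L)
    (hs : Summable fun n : ℕ => ((n : ℝ) + 1) * P n * (Real.log (P n) - Real.log (P (n + 1)))) :
    relEntropy (massMinus P) (massPlus P) ≠ ∞ ∧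
      (1 + L) * (relEntropy (massMinus P) (massPlus P)).toReal =
        ∑' n : ℕ, ((n : ℝ) + 1) * P n * (Real.log (P n) - Real.log (P (n + 1))) +
          (1 + L) * (Real.log L - Real.log (1 + L)) := by
  have hmean : massMean P = L := hm.tsum_eq
  have hminus := isMassFunction_massMinus hL hP hm
  have hplus := isMassFunction_massPlus hL hP hm
  have hplus0 : ∀ n, 0 < massPlus P n := fun n => by
    have := hpos (n + 1)
    rw [massPlus, hmean]
    positivity
  have hL1 : 0 < 1 + L := by linarith
  have hsum : HasSum (fun n => massMinus P n * Real.log (massMinus P n / massPlus P n))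
      ((∑' n : ℕ, ((n : ℝ) + 1) * P n * (Real.log (P n) - Real.log (P (n + 1)))) / (1 + L) +
        1 * (Real.log L - Real.log (1 + L))) := by
    have h := (hs.hasSum.div_const (1 + L)).add
      (hminus.hasSum.mul_right (Real.log L - Real.log (1 + L)))
    have e : (fun n => massMinus P n * Real.log (massMinus P n / massPlus P n)) = fun n : ℕ =>
        ((n : ℝ) + 1) * P n * (Real.log (P n) - Real.log (P (n + 1))) / (1 + L) +
          massMinus P n * (Real.log L - Real.log (1 + L)) := by
      ext n
      rw [log_massMinus_div_massPlus (hmean ▸ hL) hpos, massMinus, hmean]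
      ring
    rw [e]
    exact h
  obtain ⟨h1, h2⟩ := relEntropy_eq_tsum hminus hplus hplus0 hsum.summable
  refine ⟨h1, ?_⟩
  rw [h2, hsum.tsum_eq]
  field_simp

theorem relEntropy_massPlus_massMinus {P : ℕ → ℝ} {L : ℝ} (hL : 0 < L) (hP : IsMassFunction P)
    (hpos : ∀ n, 0 < P n) (hm : HasSum (fun n : ℕ => (n : ℝ) * P n) L)
    (hs : Summable fun n : ℕ =>
      ((n : ℝ) + 1) * P (n + 1) * (Real.log (P n) - Real.log (P (n + 1)))) :
    relEntropy (massPlus P) (massMinus P) ≠ ∞ ∧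
      L * (relEntropy (massPlus P) (massMinus P)).toReal =
        L * (Real.log (1 + L) - Real.log L) -
          ∑' n : ℕ, ((n : ℝ) + 1) * P (n + 1) * (Real.log (P n) - Real.log (P (n + 1))) := by
  have hmean : massMean P = L := hm.tsum_eq
  have hminus := isMassFunction_massMinus hL hP hm
  have hplus := isMassFunction_massPlus hL hP hm
  have hminus0 : ∀ n, 0 < massMinus P n := fun n => by
    have := hpos n
    rw [massMinus, hmean]
    positivity
  have hsum : HasSum (fun n => massPlus P n * Real.log (massPlus P n / massMinus P n))
      (1 * (Real.log (1 + L) - Real.log L) -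
        (∑' n : ℕ, ((n : ℝ) + 1) * P (n + 1) * (Real.log (P n) - Real.log (P (n + 1)))) / L) := by
    have h := (hplus.hasSum.mul_right (Real.log (1 + L) - Real.log L)).sub
      (hs.hasSum.div_const L)
    have e : (fun n => massPlus P n * Real.log (massPlus P n / massMinus P n)) = fun n : ℕ =>
        massPlus P n * (Real.log (1 + L) - Real.log L) -
          ((n : ℝ) + 1) * P (n + 1) * (Real.log (P n) - Real.log (P (n + 1))) / L := by
      ext n
      rw [← inv_div, Real.log_inv, log_massMinus_div_massPlus (hmean ▸ hL) hpos, massPlus, hmean]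
      ring
    rw [e]
    exact h
  obtain ⟨h1, h2⟩ := relEntropy_eq_tsum hplus hminus hminus0 hsum.summable
  refine ⟨h1, ?_⟩
  rw [h2, hsum.tsum_eq]
  field_simp

end

/-! ### The derivative formula -/

theorem theorem4 (pX : ℕ → ℝ) (hX : IsMassFunction pX)
    (hmean : Summable fun n : ℕ => (n : ℝ) * pX n)
    (lY : ℝ) (hlY : 0 < lY)
    (lam : ℝ → ℝ) (hlam : ∀ η, lam η = η * massMean pX + (1 - η) * lY)
    (pZ : ℝ → ℕ → ℝ) (hpZ : ∀ η, pZ η = beamsplitterAdd η pX (geometricMass lY))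
    (η : ℝ) (hη : η ∈ Set.Ioo (0 : ℝ) 1) :
    IsMassFunction (pZ η) ∧
    HasSum (fun n : ℕ => (n : ℝ) * pZ η n) (lam η) ∧
    IsMassFunction (massPlus (pZ η)) ∧
    IsMassFunction (massMinus (pZ η)) ∧
    relEntropy (pZ η) (geometricMass (lam η)) ≠ ∞ ∧
    relEntropy (massMinus (pZ η)) (massPlus (pZ η)) ≠ ∞ ∧
    relEntropy (massPlus (pZ η)) (massMinus (pZ η)) ≠ ∞ ∧
    HasDerivAt (fun t : ℝ => (relEntropy (pZ t) (geometricMass (lam t))).toReal)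
      (lY * (1 + lam η) / η *
          (relEntropy (massMinus (pZ η)) (massPlus (pZ η))).toReal +
        (1 + lY) * lam η / η *
          (relEntropy (massPlus (pZ η)) (massMinus (pZ η))).toReal) η := by
  have hpZ' : ∀ t ∈ Set.Ioo (0 : ℝ) 1, pZ t = attenuated pX lY t := fun t ht => by
    rw [hpZ, beamsplitterAdd_eq_amplified_thinned hX hlY ht, attenuated]
  have hη0 := hη.1
  have hη1 := hη.2
  have ha0 : 0 ≤ massMean pX := tsum_nonneg fun n => mul_nonneg n.cast_nonneg (hX.nonneg n)
  have hlam0 : ∀ t ∈ Set.Ioo (0 : ℝ) 1, 0 < lam t := fun t ht => by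
    rw [hlam]
    have h1 := mul_nonneg ht.1.le ha0
    have h2 : 0 < (1 - t) * lY := mul_pos (by linarith [ht.2]) hlY
    linarith
  -- A neighbourhood of `η` whose closure lies in `(0, 1)`, so that the ratio bounds are uniform on
  -- it.
  set U := Set.Ioo (η / 2) ((1 + η) / 2) with hU
  have hηU : η ∈ U := ⟨by linarith, by linarith⟩
  have hU01 : ∀ t ∈ U, t ∈ Set.Ioo (0 : ℝ) 1 := fun t ht =>
    ⟨by linarith [ht.1], by linarith [ht.2]⟩
  obtain ⟨a, ha, c, hc, C, hbd⟩ := attenuated_bounds hX hlY (t₁ := η / 2) (t₂ := (1 + η) / 2)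
    (by linarith) (by linarith)
  have hr : ∀ t ∈ U, HasRatioBounds a c C (attenuated pX lY t) := fun t ht =>
    ⟨(hbd t ⟨ht.1.le, ht.2.le⟩).1, fun n => ((hbd t ⟨ht.1.le, ht.2.le⟩).2 n).1,
      fun n => ((hbd t ⟨ht.1.le, ht.2.le⟩).2 n).2⟩
  have hP : ∀ t ∈ U, IsMassFunction (attenuated pX lY t) := fun t ht =>
    isMassFunction_attenuated hX hlY (hU01 t ht)
  have hpos : ∀ t ∈ U, ∀ n, 0 < attenuated pX lY t n := fun t ht => (hr t ht).pos ha hc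
  have hm1 : ∀ t ∈ U, HasSum (fun n : ℕ => ((n : ℝ) + 1) * attenuated pX lY t n) (1 + lam t) :=
    fun t ht => by
      rw [hlam]
      exact hasSum_succ_mul_attenuated hX hmean.hasSum hlY (hU01 t ht)
  have hm : ∀ t ∈ U, HasSum (fun n : ℕ => (n : ℝ) * attenuated pX lY t n) (lam t) :=
    fun t ht => hasSum_nat_mul_of_succ (hP t ht) (hm1 t ht)
  have hC : 0 ≤ C := by
    by_contra! hC
    have h1 := (hr η hηU).le_mul 0
    have h2 := hpos η hηU 0
    have h3 := hpos η hηU 1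
    simp only [zero_add] at h1
    nlinarith
  have hlam_deriv : ∀ t, HasDerivAt lam (massMean pX - lY) t := fun t => by
    rw [funext hlam]
    have := ((hasDerivAt_id t).mul_const (massMean pX)).add
      (((hasDerivAt_id t).const_sub 1).mul_const lY)
    exact this.congr_deriv (by ring)
  have hS := hasDerivAt_tsum_mul_log (U := U) isOpen_Ioo (P := attenuated pX lY)
    (J := fun t n => 1 / t * attenuatedCurrent pX lY t n) (M := fun t => 1 + lam t)
    -- On `U` one has `1 / t ≤ 2 / η`, and the upper ratio bound replaces the mass at `n + 1` by `C`
    -- times that at `n`.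
    (B := 2 / η * (lY + (1 + lY) * C)) ha hc (by positivity) hP
    (fun t _ => ((hlam_deriv t).continuousAt.continuousWithinAt).const_add 1) hm1 hr
    (fun t ht n => by
      cases n with
      | zero => simpa using hasDerivAt_attenuated_zero hX hlY (hU01 t ht)
      | succ n =>
        refine (hasDerivAt_attenuated_succ hX hlY (hU01 t ht) n).congr_deriv ?_
        rw [if_neg (Nat.succ_ne_zero n), Nat.add_sub_cancel, mul_sub])
    (fun t ht n => by
      have ht0 := (hU01 t ht).1
      have h0 := hpos t ht n
      have h1 := hpos t ht (n + 1)
      have h2 := (hr t ht).le_mul n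
      rw [abs_mul, abs_of_pos (by positivity : 0 < 1 / t), mul_assoc]
      have h3 : 1 / t ≤ 2 / η := by
        rw [div_le_div_iff₀ ht0 hη0]
        linarith [ht.1]
      refine mul_le_mul h3 ?_ (abs_nonneg _) (by positivity)
      rw [attenuatedCurrent]
      refine (abs_sub _ _).trans ?_
      rw [abs_of_nonneg (by positivity), abs_of_nonneg (by positivity)]
      calc lY * ((n + 1) * attenuated pX lY t n) +
            (1 + lY) * ((n + 1) * attenuated pX lY t (n + 1)) ≤
          lY * ((n + 1) * attenuated pX lY t n) +
            (1 + lY) * ((n + 1) * (C * attenuated pX lY t n)) := by gcongr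
        _ = _ := by ring) hηU
  set P := attenuated pX lY η with hPdef
  have hs1 : Summable fun n : ℕ => ((n : ℝ) + 1) * P n * (Real.log (P n) - Real.log (P (n + 1))) :=
    (hr η hηU).summable_mul_log_sub ha hc (hm1 η hηU).summable (B := 1) fun n => by
      have := hpos η hηU n
      rw [one_mul, abs_of_nonneg (by positivity)]
  have hs2 : Summable fun n : ℕ =>
      ((n : ℝ) + 1) * P (n + 1) * (Real.log (P n) - Real.log (P (n + 1))) :=
    (hr η hηU).summable_mul_log_sub ha hc (hm1 η hηU).summable (B := C) fun n => by
      have h1 := hpos η hηU (n + 1)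
      have h2 := (hr η hηU).le_mul n
      rw [abs_of_nonneg (by positivity)]
      calc ((n : ℝ) + 1) * P (n + 1) ≤ (n + 1) * (C * P n) := by gcongr
        _ = _ := by ring
  have hL := hlam0 η hη
  have hgeo : ∀ t ∈ U, relEntropy (pZ t) (geometricMass (lam t)) ≠ ∞ ∧
      (relEntropy (pZ t) (geometricMass (lam t))).toReal =
        ∑' n, attenuated pX lY t n * Real.log (attenuated pX lY t n) +
          ((1 + lam t) * Real.log (1 + lam t) - lam t * Real.log (lam t)) := fun t ht => by
    rw [hpZ' t (hU01 t ht)]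
    exact relEntropy_geometricMass (hlam0 t (hU01 t ht)) (hP t ht) (hpos t ht) (hm t ht)
      ((hr t ht).summable_mul_log ha hc (hP t ht) (hm1 t ht).summable)
  obtain ⟨hmp, hmp_eq⟩ := relEntropy_massMinus_massPlus hL (hP η hηU) (hpos η hηU) (hm η hηU) hs1
  obtain ⟨hpm, hpm_eq⟩ := relEntropy_massPlus_massMinus hL (hP η hηU) (hpos η hηU) (hm η hηU) hs2
  have hgeoη := (hgeo η hηU).1
  rw [hpZ' η hη] at hgeoη ⊢
  refine ⟨hP η hηU, hm η hηU, isMassFunction_massPlus hL (hP η hηU) (hm η hηU),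
    isMassFunction_massMinus hL (hP η hηU) (hm η hηU), hgeoη, hmp, hpm, ?_⟩
  have hcong : (fun t : ℝ => (relEntropy (pZ t) (geometricMass (lam t))).toReal) =ᶠ[nhds η]
      fun t => ∑' n, attenuated pX lY t n * Real.log (attenuated pX lY t n) +
          ((1 + lam t) * Real.log (1 + lam t) - lam t * Real.log (lam t)) := by
    filter_upwards [isOpen_Ioo.mem_nhds hηU] with t ht using (hgeo t ht).2
  refine HasDerivAt.congr_of_eventuallyEq ?_ hcong
  have d1 := (Real.hasDerivAt_mul_log (show 1 + lam η ≠ 0 by linarith)).comp η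
    ((hlam_deriv η).const_add 1)
  have d2 := (Real.hasDerivAt_mul_log hL.ne').comp η (hlam_deriv η)
  refine (hS.add (d1.sub d2)).congr_deriv ?_
  have hR : ∑' n, 1 / η * attenuatedCurrent pX lY η n * (Real.log (P n) - Real.log (P (n + 1))) =
      1 / η * (lY * (∑' n : ℕ, ((n : ℝ) + 1) * P n * (Real.log (P n) - Real.log (P (n + 1)))) -
        (1 + lY) * ∑' n : ℕ,
          ((n : ℝ) + 1) * P (n + 1) * (Real.log (P n) - Real.log (P (n + 1)))) := by
    rw [← (((hs1.hasSum.mul_left lY).sub (hs2.hasSum.mul_left (1 + lY))).mul_left (1 / η)).tsum_eq]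
    refine tsum_congr fun n => ?_
    rw [attenuatedCurrent, ← hPdef]
    ring
  rw [hR]
  -- This eliminates the mean of `X`. The coefficients of `log (1 + λ) - log λ` then agree because
  -- `(1 + lY) λ - lY (1 + λ) = λ - lY`.
  have e1 : massMean pX - lY = (lam η - lY) / η := by
    rw [hlam]
    field_simp
    ring
  rw [e1]
  field_simp
  linear_combination (-lY) * hmp_eq - (1 + lY) * hpm_eq
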